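/- Let $J_\nu(z)=\sum_{n\ge 0}\frac{(-1)^n}{n!\,\Gamma(\nu+n+1)}\left(\frac z2\right)^{2n+\nu}$ be the Bessel function of the first kind, $\mathbb D=\{z\in\mathbb C:|z|<1\}$, and for real $\nu>-1$ let $$f_\nu(z)=2^{\nu}\Gamma(\nu+1)z^{1-\nu/2}J_\nu(\sqrt z)=\sum_{n\ge0}\frac{(-1)^n\Gamma(\nu+1)}{4^n\,n!\,\Gamma(\nu+n+1)}z^{n+1},$$ which is an entire function. A function holomorphic in $\mathbb D$ is called convex if it is univalent in $\mathbb D$ and maps $\mathbb D$ onto a convex domain; starlike if it is univalent in $\mathbb D$, vanishes at $0$, and maps $\mathbb D$ onto a domain starlike with respect to $0$; and close-to-convex if there is a convex function $g$ on $\mathbb D$ with $\operatorname{Re}(f'(z)/g'(z))>0$ for all $z\in\mathbb D$. (a) The equation $f_\nu'(1)=0$ has a unique root $\nu_0$ in $(-1,\infty)$; it satisfies $-0.5624<\nu_0<-0.5623$ (so $\nu_0=-0.5623\ldots$). For $\nu>-1$, the function $f_\nu$ is starlike and all its derivatives $f_\nu^{(k)}$, $k\ge1$, are close-to-convex in $\mathbb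 D$ if and only if $\nu\ge\nu_0$. (b) The equation $3J_\nu(1)+2(\nu-2)J_{\nu+1}(1)=0$ has a unique root $\nu_1$ in $(-1,\infty)$; it satisfies $-0.1439<\nu_1<-0.1438$ (so $\nu_1=-0.1438\ldots$). For $\nu>-1$, the function $f_\nu$ and all its derivatives $f_\nu^{(k)}$, $k\ge1$, are convex in $\mathbb D$ if and only if $\nu\ge\nu_1$. -/

import Mathlib

noncomputable section

/-- The Bessel function of the first kind `J_ν(z)`, with principal branch of `(z/2)^ν`.
At the poles of `Γ` the convention `Γ = 0` makes the corresponding terms vanish, as they should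
since `1/Γ` vanishes there. -/
def besselJ (ν z : ℂ) : ℂ :=
  (z / 2) ^ ν *
    ∑' n : ℕ, (-1) ^ n / ((n.factorial : ℂ) * Complex.Gamma (ν + n + 1)) * (z / 2) ^ (2 * n)

/-- The normalized Bessel function `f_ν(z) = 2^ν Γ(ν+1) z^{1-ν/2} J_ν(√z)`
(all powers are principal). -/
def normalizedBessel (ν : ℝ) (z : ℂ) : ℂ :=
  2 ^ (ν : ℂ) * Complex.Gamma ((ν : ℂ) + 1) * z ^ (1 - (ν : ℂ) / 2) *
    besselJ ν (z ^ (1 / 2 : ℂ))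

/-- The branches cancel: `f_ν` is given on all of `ℂ` by its (everywhere convergent) power
series, so it is an entire function. -/
theorem normalizedBessel_eq_tsum (ν : ℝ) (z : ℂ) :
    normalizedBessel ν z = ∑' n : ℕ, (-1) ^ n * Complex.Gamma ((ν : ℂ) + 1) * z ^ (n + 1) /
      (4 ^ n * (n.factorial : ℂ) * Complex.Gamma ((ν : ℂ) + n + 1)) := by
  unfold normalizedBessel besselJ
  by_cases hz : z = 0
  · subst hz
    by_cases h : (1 : ℂ) - (ν : ℂ) / 2 = 0
    · have hν : (ν : ℂ) ≠ 0 := by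
        intro h0
        simp [h0] at h
      simp [hν]
    · simp [Complex.zero_cpow h]
  · have hs : (z ^ (1 / 2 : ℂ)) ^ 2 = z := by
      rw [← Complex.cpow_nat_mul]
      norm_num
    have h2 : ((2 : ℂ)) ^ (ν : ℂ) ≠ 0 := by
      simp [Complex.cpow_eq_zero_iff]
    have harg := Complex.arg_mem_Ioc z
    have hpow : (z ^ (1 / 2 : ℂ) / 2) ^ (ν : ℂ) = z ^ ((ν : ℂ) / 2) / 2 ^ (ν : ℂ) := by
      have e1 : (z ^ (1 / 2 : ℂ)) = 2 * (z ^ (1 / 2 : ℂ) / 2) := by ring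
      have e2 : (z ^ (1 / 2 : ℂ)) ^ (ν : ℂ) = z ^ ((ν : ℂ) / 2) := by
        have him : (Complex.log z * (1 / 2)).im = z.arg / 2 := by
          have : Complex.log z * (1 / 2) = ((1 / 2 : ℝ) : ℂ) * Complex.log z := by
            push_cast; ring
          rw [this, Complex.im_ofReal_mul,
            Complex.log_im]
          ring
        rw [← Complex.cpow_mul]
        · congr 1; ring
        · rw [him]; linarith [harg.1, Real.pi_pos]
        · rw [him]; linarith [harg.2, Real.pi_pos]
      have e3 : (z ^ (1 / 2 : ℂ)) ^ (ν : ℂ)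
          = 2 ^ (ν : ℂ) * (z ^ (1 / 2 : ℂ) / 2) ^ (ν : ℂ) := by
        conv_lhs => rw [e1]
        have hw : z ^ (1 / 2 : ℂ) / 2 ≠ 0 := by
          intro h0
          apply hz
          rw [← hs, e1, h0]; simp
        have hl := Complex.log_ofReal_mul (r := 2) (by norm_num) hw
        rw [Complex.ofReal_log (by norm_num)] at hl
        push_cast at hl
        rw [Complex.cpow_def_of_ne_zero (mul_ne_zero two_ne_zero hw),
          Complex.cpow_def_of_ne_zero two_ne_zero, Complex.cpow_def_of_ne_zero hw, hl,
          ← Complex.exp_add]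
        congr 1; ring
      rw [e2] at e3
      rw [e3]; field_simp
    have hprod : z ^ (1 - (ν : ℂ) / 2) * z ^ ((ν : ℂ) / 2) = z := by
      rw [← Complex.cpow_add _ _ hz]
      simp
    rw [hpow, ← tsum_mul_left, ← tsum_mul_left]
    refine tsum_congr fun n => ?_
    have h4 : (z ^ (1 / 2 : ℂ) / 2) ^ (2 * n) = z ^ n / 4 ^ n := by
      rw [pow_mul, div_pow, hs, div_pow]; norm_num
    rw [h4, pow_succ]
    calc _ = (2 ^ (ν : ℂ) / 2 ^ (ν : ℂ)) * (z ^ (1 - (ν : ℂ) / 2) * z ^ ((ν : ℂ) / 2)) *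
          ((-1) ^ n * Complex.Gamma ((ν : ℂ) + 1) * z ^ n /
            (4 ^ n * (n.factorial : ℂ) * Complex.Gamma ((ν : ℂ) + n + 1))) := by ring
      _ = _ := by rw [hprod, div_self h2]; ring

/-- `f` is starlike in the open unit disk: holomorphic and univalent there, with `f 0 = 0`,
and the image of the disk is starlike with respect to the origin. -/
def IsStarlikeOnDisk (f : ℂ → ℂ) : Prop :=
  DifferentiableOn ℂ f (Metric.ball 0 1) ∧ Set.InjOn f (Metric.ball 0 1) ∧ f 0 = 0 ∧
    StarConvex ℝ 0 (f '' Metric.ball 0 1)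

/-- `f` is convex in the open unit disk: holomorphic and univalent there, and the image of the
disk is a convex domain. -/
def IsConvexOnDisk (f : ℂ → ℂ) : Prop :=
  DifferentiableOn ℂ f (Metric.ball 0 1) ∧ Set.InjOn f (Metric.ball 0 1) ∧
    Convex ℝ (f '' Metric.ball 0 1)

/-- `f` is close-to-convex in the open unit disk: holomorphic there, and there is a convex
function `g` of the disk such that `Re (f'/g') > 0` throughout the disk. -/
def IsCloseToConvexOnDisk (f : ℂ → ℂ) : Prop :=
  DifferentiableOn ℂ f (Metric.ball 0 1) ∧
    ∃ g : ℂ → ℂ, IsConvexOnDisk g ∧ ∀ z ∈ Metric.ball (0 : ℂ) 1, 0 < (deriv f z / deriv g z).re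

end

/-! Write `g(z) = f_ν(z)/z` and `H = -z g'/g`. Everything is governed by two real numbers: `f_ν'(1)`
for part (a) and `(z f_ν')'(1)` for part (b). These are the values at `1` of the series with
coefficients `weightedCoeff ν p`, `p = 1, 2`.

Sufficiency. For `ν ≥ -9/16` the linear coefficient of either series is negative and outweighs the
rest, so its real part on the disk exceeds its value at `1` (`re_weighted_lt`). Hence `f_ν'(1) ≥ 0`
gives `Re f_ν' > 0` and univalence. Bessel's equation turns into the Riccati equation `z H' = H² - ν
H + z/4`, whose recursion forces nonnegative Taylor coefficients (`nonnegTaylor_of_riccati`), so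
`|H(z)| ≤ H(|z|)`, and likewise for `H'`. Since `z f_ν'/f_ν = 1 - H` and `1 + z f_ν''/f_ν' = 1 - (H
+ z H'/(1 - H))`, positivity of both real parts reduces to the radius `[0, 1)`, where it follows
from `f_ν'(r) > 0` and `(z f_ν')'(r) > 0`. The geometric criteria `starConvex_image_of_re_pos` and
`isConvexOnDisk_of_re_pos` are proved from scratch. The derivatives of order at least one impose no
sharper condition: their coefficients decay so fast that crude ratio tests suffice.

Necessity. If `f_ν'(1) < 0`, then `f_ν` is not monotone on `(-1, 1)` and so not injective. If
`f_ν'(1) ≥ 0` and `f_ν` is convex, symmetry under conjugation makes `Re f_ν` maximal at `1` on the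
closed disk; the second derivative along the unit circle there is `-(z f_ν')'(1)`, so this number is
nonnegative.

Thresholds. Multiplied by `ν + 1`, each of the two numbers is `ν` plus a constant plus a function of
`ν` with Lipschitz constant `1/2`, hence strictly increasing and continuous (`pser_weighted_lt`,
`continuousOn_pser_weighted`). Signs at four-decimal endpoints locate the roots. The equation in (b)
is `4 (z f_ν')'(1) = 0` up to a nonzero factor (`besselJ_combination`). -/

open Filter Topology

/-! ### Everywhere convergent power series with real coefficients -/

/-- Real coefficient sequences whose power series converges everywhere. -/
def RapidDecay (a : ℕ → ℝ) : Prop := ∀ r : ℝ, 0 ≤ r → Summable fun n => |a n| * r ^ n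

/-- The sum of the power series with real coefficients `a`. -/
noncomputable def pser (a : ℕ → ℝ) (z : ℂ) : ℂ := ∑' n, (a n : ℂ) * z ^ n

/-- The coefficients of the derivative of a power series. -/
def shiftCoeff (a : ℕ → ℝ) (n : ℕ) : ℝ := (n + 1) * a (n + 1)

theorem RapidDecay.shift {a : ℕ → ℝ} (ha : RapidDecay a) : RapidDecay (shiftCoeff a) := by
  intro r hr
  -- Doubling the radius absorbs the factor `n + 1 ≤ 2 ^ (n + 1)`; the extra `+ 1` makes the base at
  -- least one, so that the exponent may be raised.
  have h := (summable_nat_add_iff 1).2 (ha (2 * (r + 1)) (by positivity))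
  refine Summable.of_nonneg_of_le (fun n => by positivity) (fun n => ?_) h
  have h1 : ((n : ℝ) + 1) ≤ 2 ^ (n + 1) := by
    exact_mod_cast (Nat.lt_two_pow_self (n := n + 1)).le
  have h2 : r ^ n ≤ (r + 1) ^ (n + 1) :=
    (pow_le_pow_left₀ hr (by linarith) n).trans (pow_le_pow_right₀ (by linarith) (by omega))
  calc |shiftCoeff a n| * r ^ n = |a (n + 1)| * (((n : ℝ) + 1) * r ^ n) := by
        rw [shiftCoeff, abs_mul, abs_of_nonneg (by positivity : (0 : ℝ) ≤ (n : ℝ) + 1)]; ring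
    _ ≤ |a (n + 1)| * (2 ^ (n + 1) * (r + 1) ^ (n + 1)) := by gcongr
    _ = _ := by rw [mul_pow]

theorem RapidDecay.shift_iterate {a : ℕ → ℝ} (ha : RapidDecay a) (k : ℕ) :
    RapidDecay (shiftCoeff^[k] a) := by
  induction k with
  | zero => exact ha
  | succ k ih => rw [Function.iterate_succ_apply']; exact ih.shift

theorem RapidDecay.summable_norm {a : ℕ → ℝ} (ha : RapidDecay a) (z : ℂ) :
    Summable fun n => ‖(a n : ℂ) * z ^ n‖ := by
  simpa using ha ‖z‖ (norm_nonneg z)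

theorem RapidDecay.hasSum {a : ℕ → ℝ} (ha : RapidDecay a) (z : ℂ) :
    HasSum (fun n => (a n : ℂ) * z ^ n) (pser a z) :=
  (ha.summable_norm z).of_norm.hasSum

theorem RapidDecay.summable_abs {a : ℕ → ℝ} (ha : RapidDecay a) : Summable fun n => |a n| := by
  simpa using ha 1 zero_le_one

theorem RapidDecay.hasSum_real {a : ℕ → ℝ} (ha : RapidDecay a) (x : ℝ) :
    HasSum (fun n => a n * x ^ n) (pser a x).re := by
  simpa [← Complex.ofReal_pow, ← Complex.ofReal_mul] using Complex.hasSum_re (ha.hasSum x)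

theorem pser_conj (a : ℕ → ℝ) (z : ℂ) :
    pser a (starRingEnd ℂ z) = starRingEnd ℂ (pser a z) := by
  simp [pser, Complex.conj_tsum]

theorem pser_ofReal (a : ℕ → ℝ) (x : ℝ) : pser a x = ((pser a x).re : ℂ) := by
  have h := pser_conj a x
  rw [Complex.conj_ofReal] at h
  exact (Complex.conj_eq_iff_re.1 h.symm).symm

theorem pser_zero (a : ℕ → ℝ) : pser a 0 = a 0 := by
  rw [pser, tsum_eq_single 0]
  · simp
  · intro n hn; simp [hn]

theorem RapidDecay.hasDerivAt {a : ℕ → ℝ} (ha : RapidDecay a) (z : ℂ) :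
    HasDerivAt (pser a) (pser (shiftCoeff a) z) z := by
  set R := ‖z‖ + 1 with hR
  have hz : z ∈ Metric.ball (0 : ℂ) R := by simp [hR]
  have hd : ∀ n : ℕ, DifferentiableOn ℂ (fun w : ℂ => (a n : ℂ) * w ^ n) (Metric.ball 0 R) :=
    fun n => (by fun_prop : Differentiable ℂ fun w : ℂ => (a n : ℂ) * w ^ n).differentiableOn
  have hb : ∀ (n : ℕ) (w : ℂ), w ∈ Metric.ball (0 : ℂ) R → ‖(a n : ℂ) * w ^ n‖ ≤ |a n| * R ^ n := by
    intro n w hw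
    have : ‖w‖ ≤ R := (mem_ball_zero_iff.1 hw).le
    rw [norm_mul, norm_pow, Complex.norm_real, Real.norm_eq_abs]
    gcongr
  have hs := ha R (by positivity)
  have h1 := Complex.hasSum_deriv_of_summable_norm hs hd Metric.isOpen_ball hb hz
  have h2 := Complex.differentiableOn_tsum_of_summable_norm hs hd Metric.isOpen_ball hb
  have h3 := (h2.differentiableAt (Metric.isOpen_ball.mem_nhds hz)).hasDerivAt
  have h4 : HasSum (fun n : ℕ => deriv (fun w : ℂ => (a n : ℂ) * w ^ n) z)
      (pser (shiftCoeff a) z) := by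
    rw [← hasSum_nat_add_iff' 1]
    have : ∀ n : ℕ, deriv (fun w : ℂ => (a (n + 1) : ℂ) * w ^ (n + 1)) z
        = (shiftCoeff a n : ℂ) * z ^ n := by
      intro n
      rw [deriv_const_mul_field, deriv_pow_field]
      simp [shiftCoeff]; ring
    simp only [this]
    simpa using ha.shift.hasSum z
  rw [h1.unique h4] at h3
  exact h3

theorem RapidDecay.deriv_eq {a : ℕ → ℝ} (ha : RapidDecay a) :
    deriv (pser a) = pser (shiftCoeff a) :=
  funext fun z => (ha.hasDerivAt z).deriv

theorem RapidDecay.differentiable {a : ℕ → ℝ} (ha : RapidDecay a) : Differentiable ℂ (pser a) :=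
  fun z => (ha.hasDerivAt z).differentiableAt

theorem RapidDecay.iteratedDeriv_eq {a : ℕ → ℝ} (ha : RapidDecay a) (k : ℕ) :
    iteratedDeriv k (pser a) = pser (shiftCoeff^[k] a) := by
  induction k with
  | zero => simp
  | succ k ih =>
    rw [iteratedDeriv_succ, ih, (ha.shift_iterate k).deriv_eq, Function.iterate_succ_apply']

theorem RapidDecay.hasDerivAt_re {a : ℕ → ℝ} (ha : RapidDecay a) (x : ℝ) :
    HasDerivAt (fun x : ℝ => (pser a x).re) (pser (shiftCoeff a) x).re x :=
  (ha.hasDerivAt x).real_of_complex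

/-! ### Geometric tail bounds -/

/-- A tail of a series with geometrically decaying terms is bounded by its first term. -/
theorem tsum_tail_le_of_ratio {a : ℕ → ℝ} {q : ℝ} (hq0 : 0 ≤ q) (hq : q < 1) (N : ℕ)
    (h : ∀ n, N ≤ n → |a (n + 1)| ≤ q * |a n|) :
    Summable (fun n => |a n|) ∧ ∑' n, |a (n + N)| ≤ |a N| / (1 - q) := by
  have hb : ∀ n, |a (n + N)| ≤ |a N| * q ^ n := by
    intro n
    induction n with
    | zero => simp
    | succ n ih =>
      calc |a (n + 1 + N)| = |a (n + N + 1)| := by congr 2; ring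
        _ ≤ q * |a (n + N)| := h _ (by omega)
        _ ≤ q * (|a N| * q ^ n) := by gcongr
        _ = _ := by ring
  have hg := (summable_geometric_of_lt_one hq0 hq).mul_left |a N|
  have hs : Summable fun n => |a (n + N)| := Summable.of_nonneg_of_le (fun _ => abs_nonneg _) hb hg
  refine ⟨(summable_nat_add_iff N).1 hs, ?_⟩
  calc _ ≤ ∑' n, |a N| * q ^ n := hs.tsum_le_tsum hb hg
    _ = _ := by rw [tsum_mul_left, tsum_geometric_of_lt_one hq0 hq, div_eq_mul_inv]

theorem abs_tsum_sub_sum_le_of_ratio {a : ℕ → ℝ} {q : ℝ} (hq0 : 0 ≤ q) (hq : q < 1) (N : ℕ)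
    (h : ∀ n, N ≤ n → |a (n + 1)| ≤ q * |a n|) :
    |∑' n, a n - ∑ n ∈ Finset.range N, a n| ≤ |a N| / (1 - q) := by
  obtain ⟨h1, h2⟩ := tsum_tail_le_of_ratio hq0 hq N h
  have h3 : Summable a := h1.of_abs
  have h4 : Summable fun n => |a (n + N)| := (summable_nat_add_iff (f := fun n => |a n|) N).2 h1
  have h5 : ∑' n, a n - ∑ n ∈ Finset.range N, a n = ∑' n, a (n + N) := by
    rw [← h3.sum_add_tsum_nat_add N]; ring
  have h6 : |∑' n, a (n + N)| ≤ ∑' n, |a (n + N)| := by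
    simpa only [Real.norm_eq_abs] using
      norm_tsum_le_tsum_norm (f := fun n => a (n + N)) (by simpa only [Real.norm_eq_abs] using h4)
  rw [h5]
  exact h6.trans h2

/-! ### Openness, univalence and starlikeness -/

theorem mem_image_nhds_of_deriv_ne_zero {F : ℂ → ℂ} {U : Set ℂ} (hU : IsOpen U)
    (hF : DifferentiableOn ℂ F U) {z : ℂ} (hz : z ∈ U) (hd : deriv F z ≠ 0) :
    F '' U ∈ 𝓝 (F z) := by
  have h := ((hF.analyticAt (hU.mem_nhds hz)).hasStrictDerivAt).map_nhds_eq hd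
  rw [← h]
  exact image_mem_map (hU.mem_nhds hz)

/-- The Noshiro–Warschawski theorem. -/
theorem injOn_of_re_deriv_pos {F : ℂ → ℂ} {U : Set ℂ} (hU : IsOpen U) (hc : Convex ℝ U)
    (hF : DifferentiableOn ℂ F U) (h : ∀ z ∈ U, 0 < (deriv F z).re) : Set.InjOn F U := by
  intro z hz w hw hzw
  by_contra hne
  have hwz : w - z ≠ 0 := sub_ne_zero.2 (Ne.symm hne)
  have hp : ∀ t ∈ Set.Icc (0 : ℝ) 1, z + t * (w - z) ∈ U := by
    intro t ht
    have := hc.add_smul_sub_mem hz hw ht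
    simpa using this
  -- Dividing by `w - z` makes the derivative along the segment exactly `Re F'`, so Rolle's theorem
  -- contradicts positivity.
  have hd : ∀ t ∈ Set.Icc (0 : ℝ) 1, HasDerivAt (fun t : ℝ => (F (z + t * (w - z)) / (w - z)).re)
      (deriv F (z + t * (w - z))).re t := by
    intro t ht
    have h1 : HasDerivAt (fun t : ℝ => z + (t : ℂ) * (w - z)) (w - z) t := by
      simpa using (Complex.ofRealCLM.hasDerivAt (x := t)).mul_const (w - z) |>.const_add z
    have h2 := (hF.differentiableAt (hU.mem_nhds (hp t ht))).hasDerivAt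
    have h3 := (HasDerivAt.scomp t h2 h1).div_const (w - z)
    have h4 := Complex.reCLM.hasFDerivAt.comp_hasDerivAt t h3
    have e : Complex.reCLM (((w - z) • deriv F (z + t * (w - z))) / (w - z))
        = (deriv F (z + t * (w - z))).re := by
      simp [hwz]
    rw [e] at h4
    exact h4
  obtain ⟨t, ht, h0⟩ := exists_hasDerivAt_eq_zero zero_lt_one
    (fun t ht => (hd t ht).continuousAt.continuousWithinAt) (by simp [hzw])
    (fun t ht => hd t (Set.Ioo_subset_Icc_self ht))
  exact (h _ (hp t (Set.Ioo_subset_Icc_self ht))).ne' h0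

theorem HasDerivAt.eventually_lt_of_neg {φ : ℝ → ℝ} {φ' x : ℝ} (h : HasDerivAt φ φ' x)
    (hneg : φ' < 0) : ∀ᶠ s in 𝓝[>] x, φ s < φ x := by
  have h1 := (hasDerivAt_iff_tendsto_slope.1 h).mono_left
    (nhdsWithin_mono x (fun y (hy : x < y) => hy.ne'))
  filter_upwards [h1.eventually_lt_const hneg, self_mem_nhdsWithin] with s hs hxs
  rw [slope_def_field, div_neg_iff] at hs
  have : 0 < s - x := sub_pos.2 hxs
  rcases hs with hs | hs <;> linarith [hs.1, hs.2]

/-- The segment from `F z₀` to `0` is lifted through local inverses of `F`. Along a lift, `|z|²` has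
derivative a negative multiple of `Re (F / (z F'))`, so the lift never leaves the closed disk of
radius `|z₀|`. The parameters reached form a closed set that is open to the right, hence all of `[0,
1]`; injectivity is not needed. -/
theorem starConvex_image_of_re_pos {F : ℂ → ℂ} (hF : DifferentiableOn ℂ F (Metric.ball 0 1))
    (h0 : F 0 = 0)
    (h : ∀ z ∈ Metric.ball (0 : ℂ) 1, z ≠ 0 → 0 < (F z / (z * deriv F z)).re) :
    StarConvex ℝ 0 (F '' Metric.ball 0 1) := by
  rw [starConvex_zero_iff]
  rintro _ ⟨z₀, hz₀, rfl⟩ t₀ ht0 ht1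
  have hr : ‖z₀‖ < 1 := mem_ball_zero_iff.1 hz₀
  set K := F '' Metric.closedBall 0 ‖z₀‖ with hK
  have hsub : Metric.closedBall (0 : ℂ) ‖z₀‖ ⊆ Metric.ball 0 1 := Metric.closedBall_subset_ball hr
  have hKc : IsCompact K :=
    (isCompact_closedBall _ _).image_of_continuousOn (hF.continuousOn.mono hsub)
  suffices Set.Icc (0 : ℝ) 1 ⊆ {s : ℝ | ((1 - s : ℝ) : ℂ) * F z₀ ∈ K} by
    have := this (⟨by linarith, by linarith⟩ : 1 - t₀ ∈ Set.Icc (0 : ℝ) 1)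
    simp only [Set.mem_ofPred_eq, sub_sub_cancel] at this
    obtain ⟨z, hz, hz'⟩ := this
    exact ⟨z, hsub hz, by rw [hz']; simp⟩
  refine IsClosed.Icc_subset_of_forall_mem_nhdsWithin ?_ ?_ ?_
  · exact (hKc.isClosed.preimage (by fun_prop)).inter isClosed_Icc
  · exact ⟨z₀, by simp, by simp⟩
  rintro x ⟨⟨z, hz, hzx⟩, hx0, hx1⟩
  -- The local argument needs `z ≠ 0`. As `x < 1`, the exceptional case forces `F z₀ = 0`, and the
  -- segment is a point.
  by_cases hz0 : z = 0
  · have hw : F z₀ = 0 := by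
      rw [hz0, h0, eq_comm, mul_eq_zero, Complex.ofReal_eq_zero] at hzx
      rcases hzx with h | h
      · linarith
      · exact h
    have : {s : ℝ | ((1 - s : ℝ) : ℂ) * F z₀ ∈ K} = Set.univ := by
      ext s; simp only [hw, mul_zero, Set.mem_ofPred_eq, Set.mem_univ, iff_true]
      exact ⟨0, by simp, h0⟩
    rw [this]; exact univ_mem
  have hzU := hsub hz
  have hpos := h z hzU hz0
  have hd : deriv F z ≠ 0 := by
    intro hd; simp [hd] at hpos
  have hs := (hF.analyticAt (Metric.isOpen_ball.mem_nhds hzU)).hasStrictDerivAt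
  set inv := hs.localInverse F _ _ hd
  have hinv : HasDerivAt inv (deriv F z)⁻¹ (((1 - x : ℝ) : ℂ) * F z₀) := by
    rw [← hzx]; exact (hs.to_localInverse hd).hasDerivAt
  have hright : ∀ᶠ y in 𝓝 (F z), F (inv y) = y := hs.eventually_right_inverse hd
  have hpath : HasDerivAt (fun s : ℝ => ((1 - s : ℝ) : ℂ) * F z₀) (-F z₀) x := by
    have := ((hasDerivAt_id x).const_sub 1).ofReal_comp.mul_const (F z₀)
    simpa using this
  have hy := HasDerivAt.scomp x hinv hpath
  have hinvz : inv (((1 - x : ℝ) : ℂ) * F z₀) = z := by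
    rw [← hzx]; exact HasStrictFDerivAt.localInverse_apply_image (hs.hasStrictFDerivAt_equiv hd)
  have hn := hy.norm_sq
  have hneg : 2 * inner ℝ ((inv ∘ fun s : ℝ => ((1 - s : ℝ) : ℂ) * F z₀) x)
      (-F z₀ • (deriv F z)⁻¹) < 0 := by
    have hx1' : (0 : ℝ) < 1 - x := by linarith
    have e : F z₀ = ((1 - x)⁻¹ : ℝ) * F z := by
      rw [hzx, ← mul_assoc, ← Complex.ofReal_mul, inv_mul_cancel₀ hx1'.ne']; simp
    rw [Function.comp_apply, hinvz, Complex.inner, e, smul_eq_mul]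
    have e2 : -(((1 - x)⁻¹ : ℝ) * F z) * (deriv F z)⁻¹ * (starRingEnd ℂ) z
        = ((-(1 - x)⁻¹ * Complex.normSq z : ℝ) : ℂ) * (F z / (z * deriv F z)) := by
      rw [Complex.ofReal_mul, Complex.normSq_eq_conj_mul_self]
      push_cast
      field_simp
    rw [e2]
    rw [Complex.re_ofReal_mul]
    have : 0 < Complex.normSq z := Complex.normSq_pos.2 hz0
    have : 0 < (1 - x)⁻¹ * Complex.normSq z * (F z / (z * deriv F z)).re := by positivity
    linarith
  have hev := hn.eventually_lt_of_neg hneg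
  have hcont : Tendsto (fun s : ℝ => ((1 - s : ℝ) : ℂ) * F z₀) (𝓝[>] x) (𝓝 (F z)) := by
    rw [hzx]; exact hpath.continuousAt.tendsto.mono_left nhdsWithin_le_nhds
  filter_upwards [hev, hcont.eventually hright] with s hs1 hs2
  refine ⟨inv (((1 - s : ℝ) : ℂ) * F z₀), ?_, hs2⟩
  simp only [Function.comp_apply, hinvz] at hs1
  have h3 : ‖z‖ ≤ ‖z₀‖ := mem_closedBall_zero_iff.1 hz
  rw [mem_closedBall_zero_iff]
  exact (lt_of_pow_lt_pow_left₀ 2 (norm_nonneg _) hs1).le.trans h3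

/-! ### The analytic criterion for convexity -/

section Convexity

variable {F : ℂ → ℂ}

/-- The polar angle of the tangent direction along the circle `|z| = r`, up to `π / 2`. -/
noncomputable def tangentAngle (F : ℂ → ℂ) (r θ : ℝ) : ℝ :=
  θ + (deriv F (r * Complex.exp (θ * Complex.I))).arg

theorem circle_mem_ball {r : ℝ} (hr0 : 0 < r) (hr : r < 1) (θ : ℝ) :
    (r : ℂ) * Complex.exp (θ * Complex.I) ∈ Metric.ball (0 : ℂ) 1 := by
  rw [mem_ball_zero_iff, norm_mul, Complex.norm_exp_ofReal_mul_I, Complex.norm_real,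
    Real.norm_eq_abs, abs_of_pos hr0, mul_one]
  exact hr

theorem hasDerivAt_circle (r θ : ℝ) :
    HasDerivAt (fun θ : ℝ => (r : ℂ) * Complex.exp (θ * Complex.I))
      (r * Complex.exp (θ * Complex.I) * Complex.I) θ := by
  have h1 : HasDerivAt (fun θ : ℝ => (θ : ℂ) * Complex.I) Complex.I θ := by
    simpa using (Complex.ofRealCLM.hasDerivAt (x := θ)).mul_const Complex.I
  have := (h1.cexp).const_mul (r : ℂ)
  rw [← mul_assoc] at this
  exact this

/-- Positivity of `Re F'` keeps `F'` in the slit plane, so the principal argument is smooth and no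
continuous branch has to be chosen. -/
theorem hasDerivAt_tangentAngle (hF : DifferentiableOn ℂ F (Metric.ball 0 1))
    (h1 : ∀ z ∈ Metric.ball (0 : ℂ) 1, 0 < (deriv F z).re) {r : ℝ} (hr0 : 0 < r) (hr : r < 1)
    (θ : ℝ) : HasDerivAt (tangentAngle F r)
      (1 + (r * Complex.exp (θ * Complex.I)) * deriv (deriv F) (r * Complex.exp (θ * Complex.I)) /
        deriv F (r * Complex.exp (θ * Complex.I))).re θ := by
  have hz := circle_mem_ball hr0 hr θ
  set z : ℂ := r * Complex.exp (θ * Complex.I) with hzdef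
  have h2 := (((hF.deriv Metric.isOpen_ball).differentiableAt
    (Metric.isOpen_ball.mem_nhds hz)).hasDerivAt).clog (Or.inl (h1 z hz))
  have h3 := Complex.imCLM.hasFDerivAt.comp_hasDerivAt θ
    (HasDerivAt.scomp θ h2 (hasDerivAt_circle r θ))
  have h4 := (hasDerivAt_id θ).add h3
  have e : 1 + Complex.imCLM ((z * Complex.I) • (deriv (deriv F) z / deriv F z))
      = (1 + z * deriv (deriv F) z / deriv F z).re := by
    have : (z * Complex.I) * (deriv (deriv F) z / deriv F z)
        = (z * deriv (deriv F) z / deriv F z) * Complex.I := by ring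
    simp only [smul_eq_mul, this]
    simp
  rw [← e]
  have hfun : tangentAngle F r = id + Complex.imCLM ∘ (fun t => Complex.log (deriv F t)) ∘
      fun θ : ℝ => (r : ℂ) * Complex.exp (θ * Complex.I) := by
    funext x
    simp [tangentAngle, Complex.log_im]
  rw [hfun]
  exact h4

theorem tangentAngle_add_two_pi (F : ℂ → ℂ) (r θ : ℝ) :
    tangentAngle F r (θ + 2 * Real.pi) = tangentAngle F r θ + 2 * Real.pi := by
  have : Complex.exp (((θ + 2 * Real.pi : ℝ) : ℂ) * Complex.I) = Complex.exp (θ * Complex.I) := by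
    push_cast
    rw [add_mul, Complex.exp_add, Complex.exp_two_pi_mul_I, mul_one]
  rw [tangentAngle, this, tangentAngle]; ring

theorem mul_deriv_eq_polar (F : ℂ → ℂ) (r θ : ℝ) :
    r * Complex.exp (θ * Complex.I) * deriv F (r * Complex.exp (θ * Complex.I))
      = ((r * ‖deriv F (r * Complex.exp (θ * Complex.I))‖ : ℝ) : ℂ) *
        Complex.exp (tangentAngle F r θ * Complex.I) := by
  conv_lhs => rw [← Complex.norm_mul_exp_arg_mul_I (deriv F (r * Complex.exp (θ * Complex.I)))]
  rw [tangentAngle]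
  push_cast
  rw [add_mul, Complex.exp_add]
  ring

/-- The image of the circle stays on one side of its tangent at `F z`. The signed distance `u` has
derivative a positive multiple of `sin (ψ θ - ψ α)`, and `ψ` increases by exactly `2π` over one
turn. So `u` rises from `0` until `ψ` has gained `π`, then falls back to `0`. -/
theorem re_sub_div_nonneg_of_circle (hF : DifferentiableOn ℂ F (Metric.ball 0 1))
    (h1 : ∀ z ∈ Metric.ball (0 : ℂ) 1, 0 < (deriv F z).re)
    (h2 : ∀ z ∈ Metric.ball (0 : ℂ) 1, 0 < (1 + z * deriv (deriv F) z / deriv F z).re)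
    {r : ℝ} (hr0 : 0 < r) (hr : r < 1) {α θ : ℝ} (hθ : θ ∈ Set.Icc α (α + 2 * Real.pi)) :
    0 ≤ ((F (r * Complex.exp (α * Complex.I)) - F (r * Complex.exp (θ * Complex.I))) /
      (r * Complex.exp (α * Complex.I) * deriv F (r * Complex.exp (α * Complex.I)))).re := by
  set z : ℂ := r * Complex.exp (α * Complex.I) with hz
  set u : ℝ → ℝ := fun θ => ((F z - F (r * Complex.exp (θ * Complex.I))) / (z * deriv F z)).re
    with hu
  set ψ := tangentAngle F r with hψ
  set A : ℝ := r * ‖deriv F z‖ with hA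
  have hne : ∀ θ : ℝ, 0 < r * ‖deriv F (r * Complex.exp (θ * Complex.I))‖ := by
    intro θ
    refine mul_pos hr0 (norm_pos_iff.2 fun h => ?_)
    have := h1 _ (circle_mem_ball hr0 hr θ)
    simp [h] at this
  have hApos : 0 < A := hne α
  have hud : ∀ θ : ℝ, HasDerivAt u
      ((r * ‖deriv F (r * Complex.exp (θ * Complex.I))‖) / A * Real.sin (ψ θ - ψ α)) θ := by
    intro θ
    have hζ := circle_mem_ball hr0 hr θ
    have h3 := (hF.differentiableAt (Metric.isOpen_ball.mem_nhds hζ)).hasDerivAt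
    have h4 := ((HasDerivAt.scomp θ h3 (hasDerivAt_circle r θ)).const_sub (F z)).div_const
      (z * deriv F z)
    have h5 := Complex.reCLM.hasFDerivAt.comp_hasDerivAt θ h4
    refine h5.congr_deriv ?_
    set ζ : ℂ := r * Complex.exp (θ * Complex.I)
    have e1 : ζ * deriv F ζ = ((r * ‖deriv F ζ‖ : ℝ) : ℂ) * Complex.exp (ψ θ * Complex.I) :=
      mul_deriv_eq_polar F r θ
    have e2 : z * deriv F z = (A : ℂ) * Complex.exp (ψ α * Complex.I) := mul_deriv_eq_polar F r α
    have e3 : -((ζ * Complex.I) • deriv F ζ) / (z * deriv F z)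
        = ((r * ‖deriv F ζ‖ / A : ℝ) : ℂ) *
          (-Complex.I * Complex.exp ((ψ θ - ψ α : ℝ) * Complex.I)) := by
      have : -((ζ * Complex.I) • deriv F ζ) = -Complex.I * (ζ * deriv F ζ) := by
        rw [smul_eq_mul]; ring
      rw [this, e1, e2]
      push_cast
      rw [sub_mul, Complex.exp_sub]
      have hA' : (A : ℂ) ≠ 0 := by exact_mod_cast hApos.ne'
      field_simp
    have e4 : (-Complex.I * Complex.exp ((ψ θ - ψ α : ℝ) * Complex.I)).re
        = Real.sin (ψ θ - ψ α) := by
      rw [neg_mul, Complex.neg_re, Complex.I_mul_re, neg_neg, Complex.exp_ofReal_mul_I_im]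
    rw [e3, Complex.reCLM_apply, Complex.re_ofReal_mul, e4]
  have hψd := hasDerivAt_tangentAngle hF h1 hr0 hr
  have hmono : StrictMono ψ := strictMono_of_deriv_pos fun θ => by
    rw [(hψd θ).deriv]; exact h2 _ (circle_mem_ball hr0 hr θ)
  have hψc : Continuous ψ := continuous_iff_continuousAt.2 fun θ => (hψd θ).continuousAt
  have hend : ψ (α + 2 * Real.pi) = ψ α + 2 * Real.pi := tangentAngle_add_two_pi F r α
  obtain ⟨m, hm, hmψ⟩ : ∃ m ∈ Set.Icc α (α + 2 * Real.pi), ψ m = ψ α + Real.pi :=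
    intermediate_value_Icc (by linarith [Real.pi_pos]) hψc.continuousOn
      ⟨by linarith [Real.pi_pos], by rw [hend]; linarith [Real.pi_pos]⟩
  have hucont : ∀ s, ContinuousOn u s := fun s x _ => (hud x).continuousAt.continuousWithinAt
  have hu0 : u α = 0 := by simp [hu, ← hz]
  have hu1 : u (α + 2 * Real.pi) = 0 := by
    have : Complex.exp (((α + 2 * Real.pi : ℝ) : ℂ) * Complex.I) = Complex.exp (α * Complex.I) := by
      push_cast
      rw [add_mul, Complex.exp_add, Complex.exp_two_pi_mul_I, mul_one]
    simp only [hu, this, ← hz]; simp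
  change 0 ≤ u θ
  rcases le_total θ m with hle | hle
  · have hmon : MonotoneOn u (Set.Icc α m) := by
      refine monotoneOn_of_deriv_nonneg (convex_Icc _ _) (hucont _)
        (fun x _ => (hud x).differentiableAt.differentiableWithinAt) fun x hx => ?_
      rw [interior_Icc] at hx
      rw [(hud x).deriv]
      refine mul_nonneg (div_nonneg (hne x).le hApos.le)
        (Real.sin_nonneg_of_nonneg_of_le_pi ?_ ?_)
      · linarith [hmono hx.1]
      · linarith [hmono hx.2]
    rw [← hu0]
    exact hmon ⟨le_rfl, hm.1⟩ ⟨hθ.1, hle⟩ hθ.1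
  · have hanti : AntitoneOn u (Set.Icc m (α + 2 * Real.pi)) := by
      refine antitoneOn_of_deriv_nonpos (convex_Icc _ _) (hucont _)
        (fun x _ => (hud x).differentiableAt.differentiableWithinAt) fun x hx => ?_
      rw [interior_Icc] at hx
      rw [(hud x).deriv]
      refine mul_nonpos_of_nonneg_of_nonpos (div_nonneg (hne x).le hApos.le) ?_
      rw [← neg_nonneg, ← Real.sin_sub_pi]
      refine Real.sin_nonneg_of_nonneg_of_le_pi ?_ ?_
      · linarith [hmono hx.1]
      · linarith [hmono hx.2]
    rw [← hu1]
    exact hanti ⟨hle, hθ.2⟩ ⟨hm.2, le_rfl⟩ hθ.2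

theorem exists_circle_angle {r : ℝ} {ζ : ℂ} (h : ‖ζ‖ = r) (α : ℝ) :
    ∃ θ ∈ Set.Icc α (α + 2 * Real.pi), ζ = r * Complex.exp (θ * Complex.I) := by
  refine ⟨toIcoMod Real.two_pi_pos α ζ.arg,
    Set.Ico_subset_Icc_self (toIcoMod_mem_Ico Real.two_pi_pos α _), ?_⟩
  conv_lhs => rw [← Complex.norm_mul_exp_arg_mul_I ζ, h]
  congr 1
  rw [toIcoMod]
  push_cast
  rw [sub_mul, Complex.exp_sub]
  have : Complex.exp ((toIcoDiv Real.two_pi_pos α ζ.arg • (2 * Real.pi) : ℝ) * Complex.I) = 1 := by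
    rw [Complex.exp_eq_one_iff]
    exact ⟨toIcoDiv Real.two_pi_pos α ζ.arg, by simp [zsmul_eq_mul]; ring⟩
  push_cast at this
  rw [this, div_one]

/-- The half-plane bound passes from the circle to the disk by the maximum principle for `exp (F /
c)`, whose modulus is `exp (Re (F / c))`. -/
theorem re_sub_div_nonneg (hF : DifferentiableOn ℂ F (Metric.ball 0 1))
    (h1 : ∀ z ∈ Metric.ball (0 : ℂ) 1, 0 < (deriv F z).re)
    (h2 : ∀ z ∈ Metric.ball (0 : ℂ) 1, 0 < (1 + z * deriv (deriv F) z / deriv F z).re)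
    {r : ℝ} (hr0 : 0 < r) (hr : r < 1) {z ζ : ℂ} (hz : ‖z‖ = r) (hζ : ‖ζ‖ ≤ r) :
    0 ≤ ((F z - F ζ) / (z * deriv F z)).re := by
  set c := z * deriv F z with hc
  have hsub : Metric.closedBall (0 : ℂ) r ⊆ Metric.ball 0 1 := Metric.closedBall_subset_ball hr
  have hdiff : DifferentiableOn ℂ (fun w => Complex.exp (F w / c)) (Metric.closedBall 0 r) :=
    ((hF.mono hsub).div_const c).cexp
  have hcl : DiffContOnCl ℂ (fun w => Complex.exp (F w / c)) (Metric.ball 0 r) := by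
    refine DifferentiableOn.diffContOnCl ?_
    rwa [closure_ball _ hr0.ne']
  have hfr : ∀ w ∈ frontier (Metric.ball (0 : ℂ) r),
      ‖Complex.exp (F w / c)‖ ≤ Real.exp ((F z / c).re) := by
    intro w hw
    rw [frontier_ball _ hr0.ne', mem_sphere_zero_iff_norm] at hw
    obtain ⟨α, -, hα⟩ := exists_circle_angle hz 0
    obtain ⟨θ, hθ, hθw⟩ := exists_circle_angle hw α
    have := re_sub_div_nonneg_of_circle hF h1 h2 hr0 hr hθ
    rw [← hθw, ← hα, sub_div, Complex.sub_re] at this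
    rw [Complex.norm_exp]
    exact Real.exp_le_exp.2 (by linarith)
  have := Complex.norm_le_of_forall_mem_frontier_norm_le Metric.isBounded_ball hcl hfr
    (z := ζ) (by rw [closure_ball _ hr0.ne']; simpa using hζ)
  rw [Complex.norm_exp, Real.exp_le_exp] at this
  rw [sub_div, Complex.sub_re]
  linarith

/-- If a convex combination `w` were missing, the last point of the segment from `F 0` to `w` lying
in the image would be a boundary point, hence `F z` with `|z| = r` by openness. The supporting
functional at `z` is positive at `F 0` and nonnegative at `w`, yet vanishes in between. -/
theorem convex_image_closedBall (hF : DifferentiableOn ℂ F (Metric.ball 0 1))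
    (h1 : ∀ z ∈ Metric.ball (0 : ℂ) 1, 0 < (deriv F z).re)
    (h2 : ∀ z ∈ Metric.ball (0 : ℂ) 1, 0 < (1 + z * deriv (deriv F) z / deriv F z).re)
    {r : ℝ} (hr0 : 0 < r) (hr : r < 1) : Convex ℝ (F '' Metric.closedBall 0 r) := by
  set K := F '' Metric.closedBall 0 r with hK
  have hsub : Metric.closedBall (0 : ℂ) r ⊆ Metric.ball 0 1 := Metric.closedBall_subset_ball hr
  have hsub' : Metric.ball (0 : ℂ) r ⊆ Metric.ball 0 1 := Metric.ball_subset_ball hr.le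
  have hKc : IsCompact K :=
    (isCompact_closedBall _ _).image_of_continuousOn (hF.continuousOn.mono hsub)
  have hne : ∀ z ∈ Metric.ball (0 : ℂ) 1, deriv F z ≠ 0 := fun z hz h => by
    have := h1 z hz; simp [h] at this
  have hnhds : ∀ z ∈ Metric.ball (0 : ℂ) r, K ∈ 𝓝 (F z) := fun z hz =>
    mem_of_superset (mem_image_nhds_of_deriv_ne_zero Metric.isOpen_ball (hF.mono hsub') hz
      (hne z (hsub' hz))) (Set.image_mono Metric.ball_subset_closedBall)
  rw [convex_iff_add_mem]
  intro w₁ hw₁ w₂ hw₂ a b ha hb hab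
  set w := a • w₁ + b • w₂ with hw
  by_contra hwK
  set p := F 0 with hp
  have hpK : K ∈ 𝓝 p := hnhds 0 (Metric.mem_ball_self hr0)
  set γ : ℝ → ℂ := fun t => p + (t : ℂ) * (w - p) with hγ
  have hγc : Continuous γ := by fun_prop
  set T := Set.Icc (0 : ℝ) 1 ∩ γ ⁻¹' K with hT
  have hTc : IsCompact T := isCompact_Icc.inter_right (hKc.isClosed.preimage hγc)
  obtain ⟨t, ht, hmax⟩ := hTc.exists_isGreatest
    ⟨0, ⟨le_rfl, zero_le_one⟩, by simpa [hγ] using mem_of_mem_nhds hpK⟩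
  have ht1 : t < 1 := by
    refine lt_of_le_of_ne ht.1.2 fun h => hwK ?_
    have := ht.2
    simpa [hγ, h] using this
  have hnotnhds : K ∉ 𝓝 (γ t) := by
    intro hn
    have h3 : ∀ᶠ s in 𝓝[>] t, s ∈ γ ⁻¹' K ∧ s < 1 :=
      ((hγc.continuousAt.eventually_mem hn).and (eventually_lt_nhds ht1)).filter_mono
        nhdsWithin_le_nhds
    obtain ⟨s, ⟨hs1, hs2⟩, hs3⟩ := (h3.and self_mem_nhdsWithin).exists
    have hs3' : t < s := hs3
    exact absurd (hmax ⟨⟨ht.1.1.trans hs3'.le, hs2.le⟩, hs1⟩) (not_le.2 hs3')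
  obtain ⟨z, hz, hzt⟩ := ht.2
  have hzr : ‖z‖ = r := by
    refine le_antisymm (mem_closedBall_zero_iff.1 hz) (not_lt.1 fun h => hnotnhds ?_)
    rw [← hzt]
    exact hnhds z (mem_ball_zero_iff.2 h)
  have hL : ∀ v ∈ K, 0 ≤ ((F z - v) / (z * deriv F z)).re := by
    rintro _ ⟨ζ, hζ, rfl⟩
    exact re_sub_div_nonneg hF h1 h2 hr0 hr hzr (mem_closedBall_zero_iff.1 hζ)
  set c := z * deriv F z with hc
  have hc0 : c ≠ 0 := mul_ne_zero (norm_pos_iff.1 (by rw [hzr]; exact hr0)) (hne z (hsub hz))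
  -- Strictness: `p` is interior, so it can be moved by `ε c` inside `K`, which lowers the
  -- functional by `ε`.
  have hLp : 0 < ((F z - p) / c).re := by
    have hcont : Continuous fun ε : ℝ => p + (ε : ℂ) * c := by fun_prop
    have h3 : ∀ᶠ ε : ℝ in 𝓝[>] 0, p + (ε : ℂ) * c ∈ K :=
      ((hcont.continuousAt (x := 0)).eventually_mem (by simpa using hpK)).filter_mono nhdsWithin_le_nhds
    obtain ⟨ε, hε1, hε2⟩ := (h3.and self_mem_nhdsWithin).exists
    have hε : 0 < ε := hε2
    have h4 := hL _ hε1
    have e : (F z - (p + (ε : ℂ) * c)) / c = (F z - p) / c - ε := by field_simp; ring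
    rw [e, Complex.sub_re, Complex.ofReal_re] at h4
    linarith
  have hLw : 0 ≤ ((F z - w) / c).re := by
    have e : (F z - w) / c = a * ((F z - w₁) / c) + b * ((F z - w₂) / c) := by
      have hab' : (a : ℂ) + b = 1 := by exact_mod_cast hab
      have : F z = (a + b) * F z := by rw [hab', one_mul]
      rw [hw, Complex.real_smul, Complex.real_smul]
      conv_lhs => rw [this]
      ring
    rw [e, Complex.add_re, Complex.re_ofReal_mul, Complex.re_ofReal_mul]
    exact add_nonneg (mul_nonneg ha (hL _ hw₁)) (mul_nonneg hb (hL _ hw₂))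
  have hLz : 0 = (1 - t) * ((F z - p) / c).re + t * ((F z - w) / c).re := by
    have e : ((1 - t : ℝ) : ℂ) * ((F z - p) / c) + (t : ℂ) * ((F z - w) / c) = 0 := by
      have : F z = p + (t : ℂ) * (w - p) := hzt
      rw [this]; push_cast; ring
    have := congrArg Complex.re e
    rw [Complex.add_re, Complex.re_ofReal_mul, Complex.re_ofReal_mul] at this
    simpa using this.symm
  have := mul_pos (sub_pos.2 ht1) hLp
  have := mul_nonneg ht.1.1 hLw
  linarith

theorem isConvexOnDisk_of_re_pos (hF : DifferentiableOn ℂ F (Metric.ball 0 1))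
    (h1 : ∀ z ∈ Metric.ball (0 : ℂ) 1, 0 < (deriv F z).re)
    (h2 : ∀ z ∈ Metric.ball (0 : ℂ) 1, 0 < (1 + z * deriv (deriv F) z / deriv F z).re) :
    IsConvexOnDisk F := by
  refine ⟨hF, injOn_of_re_deriv_pos Metric.isOpen_ball (convex_ball _ _) hF h1, ?_⟩
  rw [convex_iff_add_mem]
  rintro _ ⟨z₁, hz₁, rfl⟩ _ ⟨z₂, hz₂, rfl⟩ a b ha hb hab
  rw [mem_ball_zero_iff] at hz₁ hz₂
  obtain ⟨r, hr1, hr2⟩ := exists_between (max_lt hz₁ hz₂)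
  have hr0 : 0 < r := (norm_nonneg z₁).trans_lt ((le_max_left _ _).trans_lt hr1)
  refine Set.image_mono (Metric.closedBall_subset_ball hr2)
    (convex_image_closedBall hF h1 h2 hr0 hr2 ?_ ?_ ha hb hab)
  · exact ⟨z₁, by simpa using ((le_max_left _ _).trans_lt hr1).le, rfl⟩
  · exact ⟨z₂, by simpa using ((le_max_right _ _).trans_lt hr1).le, rfl⟩

theorem IsConvexOnDisk.const_mul (h : IsConvexOnDisk F) {c : ℂ} (hc : c ≠ 0) :
    IsConvexOnDisk fun z => c * F z := by
  refine ⟨h.1.const_mul c, fun z hz w hw hzw => h.2.1 hz hw (mul_left_cancel₀ hc hzw), ?_⟩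
  have := h.2.2.linear_image (LinearMap.mulLeft ℝ c)
  rwa [Set.image_image] at this

end Convexity

/-! ### Coefficient estimates on the disk -/

theorem RapidDecay.mul_pser_shift {a : ℕ → ℝ} (ha : RapidDecay a) (z : ℂ) :
    HasSum (fun n : ℕ => ((n * a n : ℝ) : ℂ) * z ^ n) (z * pser (shiftCoeff a) z) := by
  rw [← hasSum_nat_add_iff' 1]
  have h := (ha.shift.hasSum z).mul_left z
  have e : ∀ n : ℕ, (((n + 1 : ℕ) * a (n + 1) : ℝ) : ℂ) * z ^ (n + 1)
      = z * ((shiftCoeff a n : ℂ) * z ^ n) := by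
    intro n
    rw [shiftCoeff]; push_cast; ring
  simp only [e]
  simpa using h

theorem norm_one_sub_pow_le {w : ℂ} (hw : ‖w‖ ≤ 1) (n : ℕ) : ‖1 - w ^ n‖ ≤ n * ‖1 - w‖ := by
  induction n with
  | zero => simp
  | succ n ih =>
    have h1 : 1 - w ^ (n + 1) = (1 - w ^ n) + w ^ n * (1 - w) := by ring
    have h2 : ‖w ^ n * (1 - w)‖ ≤ ‖1 - w‖ := by
      rw [norm_mul, norm_pow]
      exact mul_le_of_le_one_left (norm_nonneg _) (pow_le_one₀ (norm_nonneg _) hw)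
    rw [h1]
    push_cast
    linarith [norm_add_le (1 - w ^ n) (w ^ n * (1 - w))]

theorem norm_one_sub_sq_of_norm_eq_one {w : ℂ} (hw : ‖w‖ = 1) : ‖1 - w‖ ^ 2 = 2 * (1 - w.re) := by
  have h1 : Complex.normSq w = 1 := by rw [Complex.normSq_eq_norm_sq, hw]; norm_num
  rw [← Complex.normSq_eq_norm_sq]
  rw [Complex.normSq_apply] at h1 ⊢
  simp only [Complex.sub_re, Complex.one_re, Complex.sub_im, Complex.one_im]
  linarith

/-- On the unit circle this is the square of `|1 - w^n| ≤ n |1 - w|`. For `z = r w`, split `1 - r^n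
Re w^n = (1 - r^n) + r^n (1 - Re w^n)` and apply Bernoulli's inequality to the first term. -/
theorem one_sub_re_pow_le {z : ℂ} (hz : ‖z‖ ≤ 1) (n : ℕ) :
    1 - (z ^ n).re ≤ n ^ 2 * (1 - z.re) := by
  rcases Nat.eq_zero_or_pos n with rfl | hn
  · simp
  have hn1 : (1 : ℝ) ≤ n := by exact_mod_cast hn
  by_cases h0 : z = 0
  · subst h0
    simpa [hn.ne'] using Nat.succ_le_of_lt hn
  set r := ‖z‖ with hr
  have hr0 : 0 < r := norm_pos_iff.2 h0
  have hr0' : (r : ℂ) ≠ 0 := by exact_mod_cast hr0.ne'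
  obtain ⟨w, hw⟩ : ∃ w : ℂ, z = r * w := ⟨z / r, by field_simp⟩
  have hw1 : ‖w‖ = 1 := by
    have : r = r * ‖w‖ := by
      conv_lhs => rw [hr, hw, norm_mul, Complex.norm_real, Real.norm_eq_abs, abs_of_pos hr0]
    exact mul_left_cancel₀ hr0.ne' (by linarith)
  have h1 : 1 - (w ^ n).re ≤ n ^ 2 * (1 - w.re) := by
    have h2 := norm_one_sub_sq_of_norm_eq_one hw1
    have h3 := norm_one_sub_sq_of_norm_eq_one (w := w ^ n) (by rw [norm_pow, hw1, one_pow])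
    have h4 := pow_le_pow_left₀ (norm_nonneg _) (norm_one_sub_pow_le hw1.le n) 2
    rw [mul_pow, h2, h3] at h4
    linarith
  have h5 : 0 ≤ 1 - (w ^ n).re := by
    have := Complex.re_le_norm (w ^ n)
    rw [norm_pow, hw1, one_pow] at this
    linarith
  have h6 : 0 ≤ 1 - w.re := by
    have := Complex.re_le_norm w
    linarith
  have hb : 1 + (n : ℝ) * (r - 1) ≤ r ^ n := by
    have := one_add_mul_le_pow (a := r - 1) (by linarith) n
    simpa using this
  have hrn : r ^ n ≤ r := pow_le_of_le_one hr0.le hz hn.ne'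
  have e1 : (z ^ n).re = r ^ n * (w ^ n).re := by
    rw [hw, mul_pow, ← Complex.ofReal_pow, Complex.re_ofReal_mul]
  have e2 : z.re = r * w.re := by rw [hw, Complex.re_ofReal_mul]
  rw [e1, e2]
  have h7 : r ^ n * (1 - (w ^ n).re) ≤ r * (n ^ 2 * (1 - w.re)) :=
    mul_le_mul hrn h1 h5 hr0.le
  have h8 : (n : ℝ) * (1 - r) ≤ n ^ 2 * (1 - r) := by
    refine mul_le_mul_of_nonneg_right ?_ (by linarith)
    nlinarith
  nlinarith

/-- If the coefficient of `z` is negative and dominates the later ones, the real part of the power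
series on the disk exceeds its value at `1`. -/
theorem RapidDecay.re_lt_re {b : ℕ → ℝ} (hb : RapidDecay b)
    (hs : Summable fun n : ℕ => ((n + 2 : ℕ) : ℝ) ^ 2 * |b (n + 2)|)
    (h : ∑' n : ℕ, ((n + 2 : ℕ) : ℝ) ^ 2 * |b (n + 2)| < -b 1) {z : ℂ} (hz : ‖z‖ < 1) :
    (pser b 1).re < (pser b z).re := by
  have hz1 : 0 < 1 - z.re := by linarith [Complex.re_le_norm z]
  have h1 := Complex.hasSum_re (hb.hasSum z)
  have h2 := Complex.hasSum_re (hb.hasSum 1)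
  have h3 := h1.sub h2
  simp only [Complex.re_ofReal_mul, one_pow, mul_one, Complex.ofReal_re] at h3
  rw [← hasSum_nat_add_iff' 2] at h3
  simp only [Finset.sum_range_succ, Finset.range_zero, Finset.sum_empty, pow_zero, Complex.one_re,
    pow_one] at h3
  -- Each later term loses at most `n²|b n| (1 - Re z)`, while the linear term gains exactly `-b 1
  -- (1 - Re z)`.
  have hle : ∀ n : ℕ, -(((n + 2 : ℕ) : ℝ) ^ 2 * |b (n + 2)| * (1 - z.re))
      ≤ b (n + 2) * (z ^ (n + 2)).re - b (n + 2) := by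
    intro n
    have h4 := one_sub_re_pow_le hz.le (n + 2)
    have h5 : 0 ≤ 1 - (z ^ (n + 2)).re := by
      have := Complex.re_le_norm (z ^ (n + 2))
      rw [norm_pow] at this
      linarith [pow_le_one₀ (n := n + 2) (norm_nonneg z) hz.le]
    have h6 : b (n + 2) * (1 - (z ^ (n + 2)).re)
        ≤ |b (n + 2)| * (((n + 2 : ℕ) : ℝ) ^ 2 * (1 - z.re)) :=
      mul_le_mul (le_abs_self _) h4 h5 (abs_nonneg _)
    linarith
  have h4 := hasSum_le hle (hs.hasSum.mul_right (1 - z.re)).neg h3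
  have h5 := mul_lt_mul_of_pos_right h hz1
  linarith

/-- On the closed unit disk a power series differs from its constant term by at most the absolute sum
of the remaining coefficients. -/
theorem RapidDecay.norm_sub_le {a : ℕ → ℝ} (ha : RapidDecay a) {z : ℂ} (hz : ‖z‖ ≤ 1) :
    ‖pser a z - a 0‖ ≤ ∑' n, |a (n + 1)| := by
  have h1 := (hasSum_nat_add_iff' 1).2 (ha.hasSum z)
  simp only [Finset.range_one, Finset.sum_singleton, pow_zero, mul_one] at h1
  refine h1.norm_le_of_bounded ((summable_nat_add_iff 1).2 ha.summable_abs).hasSum fun n => ?_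
  rw [norm_mul, norm_pow, Complex.norm_real, Real.norm_eq_abs]
  exact mul_le_of_le_one_right (abs_nonneg _) (pow_le_one₀ (norm_nonneg _) hz)

/-! ### Nonnegative Taylor coefficients and the Riccati equation -/

section NonnegTaylor

open scoped ComplexOrder

/-- A holomorphic function on the disk with nonnegative Taylor coefficients at `0`. -/
structure NonnegTaylor (h : ℂ → ℂ) : Prop where
  differentiableOn : DifferentiableOn ℂ h (Metric.ball 0 1)
  nonneg : ∀ k, 0 ≤ iteratedDeriv k h 0

theorem NonnegTaylor.deriv {h : ℂ → ℂ} (H : NonnegTaylor h) : NonnegTaylor (deriv h) :=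
  ⟨H.differentiableOn.deriv Metric.isOpen_ball, fun k => by
    rw [← iteratedDeriv_succ']; exact H.nonneg (k + 1)⟩

/-- The triangle inequality on the Taylor series. The second conjunct records that the value at
`‖z‖` is real, which later allows identities there to be read over the reals. -/
theorem NonnegTaylor.norm_le {h : ℂ → ℂ} (H : NonnegTaylor h) {z : ℂ} (hz : ‖z‖ < 1) :
    ‖h z‖ ≤ (h ‖z‖).re ∧ h ‖z‖ = ((h ‖z‖).re : ℂ) := by
  have hz' : z ∈ Metric.ball (0 : ℂ) 1 := by simpa using hz
  have hr' : (‖z‖ : ℂ) ∈ Metric.ball (0 : ℂ) 1 := by simpa using hz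
  have h1 := Complex.hasSum_taylorSeries_on_ball H.differentiableOn hz'
  have h2 := Complex.hasSum_taylorSeries_on_ball H.differentiableOn hr'
  have e : ∀ n : ℕ, (n.factorial : ℂ)⁻¹ • ((‖z‖ : ℂ) - 0) ^ n • iteratedDeriv n h 0
      = (((n.factorial : ℝ)⁻¹ * ‖z‖ ^ n * (iteratedDeriv n h 0).re : ℝ) : ℂ) := by
    intro n
    have := Complex.nonneg_iff.1 (H.nonneg n)
    have h3 : iteratedDeriv n h 0 = ((iteratedDeriv n h 0).re : ℂ) :=
      Complex.ext rfl (by simpa using this.2.symm)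
    conv_lhs => rw [h3]
    simp [mul_assoc]
  simp only [e] at h2
  have h3 := Complex.hasSum_re h2
  have h4 := Complex.hasSum_im h2
  simp only [Complex.ofReal_re, Complex.ofReal_im] at h3 h4
  refine ⟨h1.norm_le_of_bounded h3 fun n => ?_, Complex.ext rfl ?_⟩
  · have := Complex.nonneg_iff.1 (H.nonneg n)
    have h5 : ‖iteratedDeriv n h 0‖ = (iteratedDeriv n h 0).re :=
      (congrArg Complex.re (Complex.norm_of_nonneg' (H.nonneg n)))
    simp [h5, mul_assoc]
  · simpa using h4.unique hasSum_zero

theorem iteratedDeriv_id_mul_deriv {h : ℂ → ℂ} (hd : DifferentiableOn ℂ h (Metric.ball 0 1))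
    (k : ℕ) : iteratedDeriv k (fun z => z * deriv h z) 0 = k * iteratedDeriv k h 0 := by
  have hU : Metric.ball (0 : ℂ) 1 ∈ 𝓝 (0 : ℂ) := Metric.ball_mem_nhds _ one_pos
  have hc : ContDiffAt ℂ k (deriv h) 0 :=
    ((hd.deriv Metric.isOpen_ball).analyticAt hU).contDiffAt
  rw [iteratedDeriv_fun_mul contDiffAt_fun_id hc]
  rcases k with _ | k
  · simp
  rw [Finset.sum_eq_single 1]
  · have : iteratedDeriv 1 (fun z : ℂ => z) 0 = 1 := by simp
    rw [this, Nat.add_sub_cancel, ← iteratedDeriv_succ']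
    simp
  · intro i _ hi
    have : iteratedDeriv i (fun z : ℂ => z) 0 = 0 := by
      have := iteratedDeriv_id (𝕜 := ℂ) (n := i) (x := 0)
      rcases i with _ | _ | i
      · simp
      · exact absurd rfl hi
      · rw [show (fun z : ℂ => z) = id from rfl, this]; simp
    rw [this]; simp
  · intro h; exact absurd (Finset.mem_range.2 (by omega)) h

/-- The solution vanishing at `0` of the Riccati equation `z h' = h² - ν h + z / 4` has
nonnegative Taylor coefficients. -/
theorem nonnegTaylor_of_riccati {h : ℂ → ℂ} {ν : ℝ} (hν : -1 < ν)
    (hd : DifferentiableOn ℂ h (Metric.ball 0 1)) (h0 : h 0 = 0)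
    (hr : ∀ z ∈ Metric.ball (0 : ℂ) 1, z * deriv h z = h z * h z - ν * h z + z * (1 / 4)) :
    NonnegTaylor h := by
  have hU : Metric.ball (0 : ℂ) 1 ∈ 𝓝 (0 : ℂ) := Metric.ball_mem_nhds _ one_pos
  refine ⟨hd, fun k => ?_⟩
  induction k using Nat.strong_induction_on with
  | _ k ih =>
  rcases Nat.eq_zero_or_pos k with rfl | hk
  · simp [h0]
  have hc : ContDiffAt ℂ k h 0 := (hd.analyticAt hU).contDiffAt
  have h1 : iteratedDeriv k (fun z => z * deriv h z) 0
      = iteratedDeriv k (fun z => h z * h z - ν * h z + z * (1 / 4)) 0 :=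
    Filter.EventuallyEq.iteratedDeriv_eq k (by filter_upwards [hU] with z hz using hr z hz)
  have hlin : (0 : ℂ) ≤ iteratedDeriv k (fun z : ℂ => z * (1 / 4)) 0 := by
    rw [iteratedDeriv_mul_const_field]
    have : (0 : ℂ) ≤ iteratedDeriv k (fun z : ℂ => z) 0 := by
      have := iteratedDeriv_id (𝕜 := ℂ) (n := k) (x := 0)
      rcases k with _ | _ | k
      · simp
      · simp
      · rw [show (fun z : ℂ => z) = id from rfl, this]; simp
    refine mul_nonneg this ?_
    rw [Complex.nonneg_iff]; norm_num
  rw [iteratedDeriv_id_mul_deriv hd, iteratedDeriv_fun_add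
    ((hc.mul hc).sub (contDiffAt_const.mul hc)) (contDiffAt_fun_id.mul contDiffAt_const),
    iteratedDeriv_fun_sub (hc.mul hc) (contDiffAt_const.mul hc), iteratedDeriv_const_mul_field,
    iteratedDeriv_fun_mul hc hc] at h1
  -- The extreme terms of the convolution contain `h 0 = 0`, so only orders strictly below `k` enter
  -- and strong induction applies. The equation then gives the `k`-th derivative after division by
  -- `k + ν > 0`.
  have hsum : (0 : ℂ) ≤ ∑ i ∈ Finset.range (k + 1),
      (k.choose i : ℂ) * iteratedDeriv i h 0 * iteratedDeriv (k - i) h 0 := by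
    refine Finset.sum_nonneg fun i hi => ?_
    have hi' : i ≤ k := Nat.lt_succ_iff.1 (Finset.mem_range.1 hi)
    rcases Nat.eq_zero_or_pos i with rfl | hi0
    · simp [h0]
    rcases hi'.eq_or_lt with rfl | hik
    · simp [h0]
    exact mul_nonneg (mul_nonneg (Nat.cast_nonneg _) (ih i hik)) (ih _ (by omega))
  have hkν : 0 < (k : ℝ) + ν := by
    have : (1 : ℝ) ≤ k := by exact_mod_cast hk
    linarith
  have hkν' : ((k : ℂ) + ν) ≠ 0 := by exact_mod_cast hkν.ne'
  have h2 : iteratedDeriv k h 0 = (((k : ℝ) + ν)⁻¹ : ℝ) *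
      (∑ i ∈ Finset.range (k + 1),
        (k.choose i : ℂ) * iteratedDeriv i h 0 * iteratedDeriv (k - i) h 0
        + iteratedDeriv k (fun z : ℂ => z * (1 / 4)) 0) := by
    rw [Complex.ofReal_inv, Complex.ofReal_add, Complex.ofReal_natCast,
      eq_inv_mul_iff_mul_eq₀ hkν']
    linear_combination h1
  rw [h2]
  refine mul_nonneg ?_ (add_nonneg hsum hlin)
  exact_mod_cast (inv_pos.2 hkν).le

end NonnegTaylor

/-! ### Ratio tests for close-to-convexity and convexity -/

theorem RapidDecay.of_abs_le {a b : ℕ → ℝ} (ha : RapidDecay a) (h : ∀ n, |b n| ≤ |a n|) :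
    RapidDecay b := fun r hr =>
  Summable.of_nonneg_of_le (fun n => by positivity)
    (fun n => mul_le_mul_of_nonneg_right (h n) (by positivity)) (ha r hr)

theorem RapidDecay.weight {a : ℕ → ℝ} (ha : RapidDecay a) (p : ℕ) :
    RapidDecay fun n => ((n : ℝ) + 1) ^ p * a n := by
  intro r hr
  refine Summable.of_nonneg_of_le (fun n => by positivity) (fun n => ?_) (ha (2 ^ p * r) (by positivity))
  have h1 : ((n : ℝ) + 1) ≤ 2 ^ n := by exact_mod_cast Nat.lt_two_pow_self (n := n)
  have h2 : ((n : ℝ) + 1) ^ p ≤ (2 ^ n) ^ p := pow_le_pow_left₀ (by positivity) h1 p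
  rw [abs_mul, abs_of_nonneg (by positivity : (0 : ℝ) ≤ ((n : ℝ) + 1) ^ p), mul_pow, ← pow_mul,
    mul_comm p n, pow_mul]
  calc _ = ((n : ℝ) + 1) ^ p * (|a n| * r ^ n) := by ring
    _ ≤ (2 ^ n) ^ p * (|a n| * r ^ n) := by gcongr
    _ = _ := by ring

theorem RapidDecay.natMul {a : ℕ → ℝ} (ha : RapidDecay a) : RapidDecay fun n => (n : ℝ) * a n :=
  (ha.weight 1).of_abs_le fun n => by
    rw [abs_mul, abs_mul, pow_one, Nat.abs_cast,
      abs_of_nonneg (by positivity : (0 : ℝ) ≤ (n : ℝ) + 1)]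
    gcongr
    linarith

theorem isConvexOnDisk_id : IsConvexOnDisk fun z => z :=
  ⟨differentiableOn_id, fun _ _ _ _ h => h, by simpa using convex_ball (0 : ℂ) 1⟩

section Criteria

variable {a : ℕ → ℝ} (ha : RapidDecay a) (h0 : a 0 ≠ 0)
include ha h0

theorem RapidDecay.re_div_pos {q : ℝ} (hq0 : 0 ≤ q) (hq : q ≤ 3 / 10)
    (h : ∀ n, |a (n + 1)| ≤ q * |a n|) {z : ℂ} (hz : ‖z‖ ≤ 1) : 0 < (pser a z / a 0).re := by
  have h1 := (tsum_tail_le_of_ratio hq0 (by linarith) 1 fun n _ => h n).2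
  have h2 := ha.norm_sub_le hz
  have hpos := abs_pos.2 h0
  -- With `q ≤ 3/10` the tail is at most `q / (1 - q) ≤ 3/7` of the leading coefficient.
  have h3 : |a 1| / (1 - q) < |a 0| := by
    rw [div_lt_iff₀ (by linarith)]
    nlinarith [h 0]
  have h0' : (a 0 : ℂ) ≠ 0 := by exact_mod_cast h0
  have h4 : ‖pser a z / a 0 - 1‖ < 1 := by
    rw [show pser a z / a 0 - 1 = (pser a z - a 0) / a 0 by field_simp, norm_div, Complex.norm_real,
      Real.norm_eq_abs, div_lt_one hpos]
    linarith
  have := (abs_le.1 (Complex.abs_re_le_norm (pser a z / a 0 - 1))).1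
  rw [Complex.sub_re, Complex.one_re] at this
  linarith

theorem isCloseToConvexOnDisk_of_ratio {F : ℂ → ℂ} (hF : ∀ z, HasDerivAt F (pser a z) z)
    {q : ℝ} (hq0 : 0 ≤ q) (hq : q ≤ 3 / 10)
    (h : ∀ n, |a (n + 1)| ≤ q * |a n|) : IsCloseToConvexOnDisk F := by
  have h0' : (a 0 : ℂ) ≠ 0 := by exact_mod_cast h0
  refine ⟨fun z _ => (hF z).differentiableAt.differentiableWithinAt, fun z => a 0 * z,
    isConvexOnDisk_id.const_mul h0', fun z hz => ?_⟩
  have : deriv (fun z : ℂ => (a 0 : ℂ) * z) z = a 0 := by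
    simp
  rw [this, (hF z).deriv]
  exact ha.re_div_pos h0 hq0 hq h (mem_ball_zero_iff.1 hz).le

theorem isConvexOnDisk_of_ratio {F : ℂ → ℂ} (hF : ∀ z, HasDerivAt F (pser a z) z)
    {q : ℝ} (hq0 : 0 ≤ q) (hq : q ≤ 1 / 4)
    (h : ∀ n, |a (n + 1)| ≤ q * |a n|) : IsConvexOnDisk F := by
  have h0' : (a 0 : ℂ) ≠ 0 := by exact_mod_cast h0
  have hpos := abs_pos.2 h0
  have hG : ∀ z, HasDerivAt (fun z => (a 0 : ℂ)⁻¹ * F z) ((a 0 : ℂ)⁻¹ * pser a z) z :=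
    fun z => (hF z).const_mul _
  have hG' : deriv (fun z => (a 0 : ℂ)⁻¹ * F z) = fun z => (a 0 : ℂ)⁻¹ * pser a z :=
    funext fun z => (hG z).deriv
  have hG'' : deriv (deriv fun z => (a 0 : ℂ)⁻¹ * F z)
      = fun z => (a 0 : ℂ)⁻¹ * pser (shiftCoeff a) z := by
    rw [hG']
    exact funext fun z => ((ha.hasDerivAt z).const_mul _).deriv
  suffices IsConvexOnDisk fun z => (a 0 : ℂ)⁻¹ * F z by
    have := this.const_mul h0'
    simpa [mul_inv_cancel_left₀ h0'] using this
  refine isConvexOnDisk_of_re_pos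
    (fun z _ => (hG z).differentiableAt.differentiableWithinAt) (fun z hz => ?_) (fun z hz => ?_)
  · rw [(hG z).deriv, mul_comm, ← div_eq_mul_inv]
    exact ha.re_div_pos h0 hq0 (by linarith) h (mem_ball_zero_iff.1 hz).le
  · have hz' : ‖z‖ ≤ 1 := (mem_ball_zero_iff.1 hz).le
    rw [hG'', hG']
    have h1 := ha.norm_sub_le hz'
    have h2 := ha.natMul.norm_sub_le hz'
    have e : pser (fun n => (n : ℝ) * a n) z = z * pser (shiftCoeff a) z :=
      (ha.mul_pser_shift z).tsum_eq
    simp only [e, Nat.cast_zero, zero_mul, Complex.ofReal_zero, sub_zero] at h2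
    have hs1 := (summable_nat_add_iff (f := fun n => |a n|) 1).2 ha.summable_abs
    have hs2 := (summable_nat_add_iff (f := fun n => |(n : ℝ) * a n|) 1).2 ha.natMul.summable_abs
    -- The sum is `∑ (n + 1)|a n|` over `n ≥ 1`. Its ratio is at most `(3/2)(1/4) = 3/8` and its
    -- first term at most `|a 0| / 2`, so it is at most `4/5 · |a 0|`. This yields `|z F''| < |F'|`.
    have h3 : ∑' n, |a (n + 1)| + ∑' n : ℕ, |((n + 1 : ℕ) : ℝ) * a (n + 1)| < |a 0| := by
      rw [← hs1.tsum_add hs2]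
      have h4 := (tsum_tail_le_of_ratio (a := fun n => ((n : ℝ) + 1) * a n) (q := 3 / 8)
        (by norm_num) (by norm_num) 1 (fun n hn => ?_)).2
      · have h5 : ∀ n : ℕ, |a (n + 1)| + |((n + 1 : ℕ) : ℝ) * a (n + 1)|
            = |(((n + 1 : ℕ) : ℝ) + 1) * a (n + 1)| := by
          intro n
          rw [abs_mul, abs_mul, Nat.abs_cast,
            abs_of_nonneg (by positivity : (0 : ℝ) ≤ ((n + 1 : ℕ) : ℝ) + 1)]
          ring
        simp only [h5]
        refine h4.trans_lt ?_
        have := h 0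
        rw [abs_mul, abs_of_nonneg (by positivity)]
        norm_num
        rw [zero_add] at this
        nlinarith
      · have hn' : (1 : ℝ) ≤ n := by exact_mod_cast hn
        push_cast
        rw [abs_mul, abs_mul, abs_of_nonneg (by positivity : (0 : ℝ) ≤ (n : ℝ) + 1 + 1),
          abs_of_nonneg (by positivity : (0 : ℝ) ≤ (n : ℝ) + 1)]
        have h5 := h n
        have h6 : |a (n + 1)| ≤ 1 / 4 * |a n| :=
          h5.trans (mul_le_mul_of_nonneg_right hq (abs_nonneg _))
        calc ((n : ℝ) + 1 + 1) * |a (n + 1)| ≤ ((n : ℝ) + 1 + 1) * (1 / 4 * |a n|) := by gcongr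
          _ ≤ _ := by nlinarith [abs_nonneg (a n)]
    have h6 : |a 0| - ‖pser a z - a 0‖ ≤ ‖pser a z‖ := by
      have := norm_sub_norm_le (a 0 : ℂ) ((a 0 : ℂ) - pser a z)
      rw [Complex.norm_real, Real.norm_eq_abs, sub_sub_cancel, norm_sub_rev] at this
      exact this
    have h7 : ‖z * pser (shiftCoeff a) z‖ < ‖pser a z‖ := by linarith
    have hne : pser a z ≠ 0 := norm_pos_iff.1 ((norm_nonneg _).trans_lt h7)
    have e2 : z * ((a 0 : ℂ)⁻¹ * pser (shiftCoeff a) z) / ((a 0 : ℂ)⁻¹ * pser a z)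
        = z * pser (shiftCoeff a) z / pser a z := by field_simp
    have h8 : ‖z * pser (shiftCoeff a) z / pser a z‖ < 1 := by
      rw [norm_div, div_lt_one (norm_pos_iff.2 hne)]; exact h7
    simp only [e2]
    have := (abs_le.1 (Complex.abs_re_le_norm (z * pser (shiftCoeff a) z / pser a z))).1
    rw [Complex.add_re, Complex.one_re]
    linarith

end Criteria

/-! ### The Taylor coefficients of the normalized Bessel function -/

section Coefficients

/-- The Taylor coefficients of `f_ν(z) / z`. -/
noncomputable def besselCoeff (ν : ℝ) (n : ℕ) : ℝ :=
  (-1) ^ n / (4 ^ n * n.factorial * ∏ i ∈ Finset.range n, (ν + 1 + i))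

/-- The Taylor coefficients of `f_ν`. -/
noncomputable def normCoeff (ν : ℝ) : ℕ → ℝ
  | 0 => 0
  | n + 1 => besselCoeff ν n

/-- The coefficients of `(z d/dz)^p f_ν(z) / z`. -/
noncomputable def weightedCoeff (ν : ℝ) (p n : ℕ) : ℝ := ((n : ℝ) + 1) ^ p * besselCoeff ν n

variable {ν : ℝ}

@[simp] theorem besselCoeff_zero (ν : ℝ) : besselCoeff ν 0 = 1 := by simp [besselCoeff]

theorem add_one_add_pos (hν : -1 < ν) (n : ℕ) : 0 < ν + 1 + n := by
  have : (0 : ℝ) ≤ n := n.cast_nonneg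
  linarith

theorem besselCoeff_succ_mul (hν : -1 < ν) (n : ℕ) :
    besselCoeff ν (n + 1) * (4 * (n + 1) * (ν + 1 + n)) = -besselCoeff ν n := by
  have h1 := add_one_add_pos hν n
  have h2 : 0 < ∏ i ∈ Finset.range n, (ν + 1 + i) :=
    Finset.prod_pos fun i _ => add_one_add_pos hν i
  have h3 : (0 : ℝ) < n.factorial := by exact_mod_cast n.factorial_pos
  rw [besselCoeff, besselCoeff, Finset.prod_range_succ, Nat.factorial_succ, pow_succ, pow_succ]
  push_cast
  field_simp

theorem besselCoeff_succ (hν : -1 < ν) (n : ℕ) :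
    besselCoeff ν (n + 1) = -besselCoeff ν n / (4 * (n + 1) * (ν + 1 + n)) := by
  have h1 := add_one_add_pos hν n
  rw [← besselCoeff_succ_mul hν n]
  field_simp

theorem abs_besselCoeff_succ (hν : -1 < ν) (n : ℕ) :
    |besselCoeff ν (n + 1)| = |besselCoeff ν n| / (4 * (n + 1) * (ν + 1 + n)) := by
  have h1 := add_one_add_pos hν n
  rw [besselCoeff_succ hν, abs_div, abs_neg,
    abs_of_pos (by positivity : (0 : ℝ) < 4 * (n + 1) * (ν + 1 + n))]

theorem rapidDecay_besselCoeff (hν : -1 < ν) : RapidDecay (besselCoeff ν) := by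
  intro r hr
  have hν' : 0 < ν + 1 := by linarith
  set C := 1 / (4 * (ν + 1)) with hC
  have hb : ∀ n, |besselCoeff ν n| ≤ C ^ n / n.factorial := by
    intro n
    induction n with
    | zero => simp
    | succ n ih =>
      rw [abs_besselCoeff_succ hν, Nat.factorial_succ, pow_succ]
      push_cast
      have h1 := add_one_add_pos hν n
      have h3 : (0 : ℝ) < n.factorial := by exact_mod_cast n.factorial_pos
      calc _ ≤ (C ^ n / n.factorial) / (4 * (n + 1) * (ν + 1)) := by
            have : ν + 1 ≤ ν + 1 + n := by linarith [(n.cast_nonneg : (0 : ℝ) ≤ n)]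
            gcongr
        _ = _ := by rw [hC]; field_simp
  refine Summable.of_nonneg_of_le (fun n => by positivity) (fun n => ?_)
    (Real.summable_pow_div_factorial (C * r))
  calc _ ≤ C ^ n / n.factorial * r ^ n := by gcongr; exact hb n
    _ = _ := by rw [mul_pow]; ring

theorem rapidDecay_normCoeff (hν : -1 < ν) : RapidDecay (normCoeff ν) := by
  intro r hr
  rw [← summable_nat_add_iff 1]
  refine ((rapidDecay_besselCoeff hν r hr).mul_left r).congr fun n => ?_
  simp only [normCoeff, pow_succ]; ring

theorem rapidDecay_weightedCoeff (hν : -1 < ν) (p : ℕ) : RapidDecay (weightedCoeff ν p) :=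
  (rapidDecay_besselCoeff hν).weight p

theorem shiftCoeff_normCoeff (ν : ℝ) : shiftCoeff (normCoeff ν) = weightedCoeff ν 1 := by
  funext n; simp [shiftCoeff, normCoeff, weightedCoeff]

theorem pser_normCoeff (hν : -1 < ν) (z : ℂ) :
    pser (normCoeff ν) z = z * pser (besselCoeff ν) z := by
  refine HasSum.tsum_eq ?_
  rw [← hasSum_nat_add_iff' 1]
  have h := ((rapidDecay_besselCoeff hν).hasSum z).mul_left z
  have e : ∀ n : ℕ, (normCoeff ν (n + 1) : ℂ) * z ^ (n + 1)
      = z * ((besselCoeff ν n : ℂ) * z ^ n) := by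
    intro n
    rw [normCoeff]; ring
  simp only [e]
  simpa [normCoeff] using h

theorem Gamma_add_nat (hν : -1 < ν) (n : ℕ) : Complex.Gamma ((ν : ℂ) + n + 1)
    = Complex.Gamma ((ν : ℂ) + 1) * (∏ i ∈ Finset.range n, (ν + 1 + i) : ℝ) := by
  induction n with
  | zero => simp
  | succ n ih =>
    have h1 := add_one_add_pos hν n
    have h2 : ((ν : ℂ) + n + 1) ≠ 0 := by
      have : ((ν : ℂ) + n + 1) = ((ν + 1 + n : ℝ) : ℂ) := by push_cast; ring
      rw [this]
      exact_mod_cast h1.ne'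
    rw [Finset.prod_range_succ, Complex.ofReal_mul, ← mul_assoc, ← ih]
    push_cast
    rw [← add_assoc, Complex.Gamma_add_one _ h2]
    ring

theorem Gamma_add_one_ne_zero (hν : -1 < ν) : Complex.Gamma ((ν : ℂ) + 1) ≠ 0 := by
  refine Complex.Gamma_ne_zero_of_re_pos ?_
  simp; linarith

theorem besselCoeff_eq_Gamma (hν : -1 < ν) (n : ℕ) : (besselCoeff ν n : ℂ)
    = (-1) ^ n * Complex.Gamma ((ν : ℂ) + 1) /
      (4 ^ n * (n.factorial : ℂ) * Complex.Gamma ((ν : ℂ) + n + 1)) := by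
  have h1 := Gamma_add_one_ne_zero hν
  have h2 : ((∏ i ∈ Finset.range n, (ν + 1 + i) : ℝ) : ℂ) ≠ 0 := by
    exact_mod_cast (Finset.prod_pos fun i _ => add_one_add_pos hν i).ne'
  have h3 : (n.factorial : ℂ) ≠ 0 := by exact_mod_cast n.factorial_pos.ne'
  rw [Gamma_add_nat hν, besselCoeff, Complex.ofReal_div, Complex.ofReal_mul, Complex.ofReal_mul]
  push_cast at h2 ⊢
  field_simp

theorem normalizedBessel_eq_pser (hν : -1 < ν) : normalizedBessel ν = pser (normCoeff ν) := by
  funext z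
  rw [pser_normCoeff hν, normalizedBessel_eq_tsum, pser, ← tsum_mul_left]
  refine tsum_congr fun n => ?_
  rw [besselCoeff_eq_Gamma hν, pow_succ]
  ring

theorem besselJ_one (hν : -1 < ν) : besselJ ν 1
    = (1 / 2 : ℂ) ^ (ν : ℂ) / Complex.Gamma ((ν : ℂ) + 1) * pser (besselCoeff ν) 1 := by
  have h1 := Gamma_add_one_ne_zero hν
  rw [besselJ, pser, div_mul_eq_mul_div, mul_div_assoc, ← tsum_div_const]
  congr 2
  funext n
  rw [besselCoeff_eq_Gamma hν, pow_mul, one_pow]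
  have : ((1 : ℂ) / 2) ^ 2 = 4⁻¹ := by norm_num
  rw [this, inv_pow]
  field_simp

theorem deriv_normalizedBessel (hν : -1 < ν) :
    deriv (normalizedBessel ν) = pser (weightedCoeff ν 1) := by
  rw [normalizedBessel_eq_pser hν, (rapidDecay_normCoeff hν).deriv_eq, shiftCoeff_normCoeff]

theorem pser_weightedCoeff_two (hν : -1 < ν) (z : ℂ) : pser (weightedCoeff ν 2) z
    = pser (weightedCoeff ν 1) z + z * pser (shiftCoeff (weightedCoeff ν 1)) z := by
  have h := ((rapidDecay_weightedCoeff hν 1).hasSum z).add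
    ((rapidDecay_weightedCoeff hν 1).mul_pser_shift z)
  refine HasSum.tsum_eq (h.congr_fun ?_)
  intro n
  simp only [weightedCoeff]
  push_cast
  ring

theorem pser_weightedCoeff_one (hν : -1 < ν) (z : ℂ) : pser (weightedCoeff ν 1) z
    = pser (besselCoeff ν) z + z * pser (shiftCoeff (besselCoeff ν)) z := by
  have h := ((rapidDecay_besselCoeff hν).hasSum z).add
    ((rapidDecay_besselCoeff hν).mul_pser_shift z)
  refine HasSum.tsum_eq (h.congr_fun ?_)
  intro n
  simp only [weightedCoeff]
  push_cast
  ring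

/-- The Bessel equation for `f_ν(z) / z`. -/
theorem bessel_ode (hν : -1 < ν) (z : ℂ) :
    z * pser (shiftCoeff (shiftCoeff (besselCoeff ν))) z
      + (ν + 1) * pser (shiftCoeff (besselCoeff ν)) z + 1 / 4 * pser (besselCoeff ν) z = 0 := by
  have hc := rapidDecay_besselCoeff hν
  have h := ((hc.shift.mul_pser_shift z).add ((hc.shift.hasSum z).mul_left ((ν : ℂ) + 1))).add
    ((hc.hasSum z).mul_left (1 / 4))
  refine h.unique ?_
  convert hasSum_zero (α := ℂ) (β := ℕ) using 2 with n
  have := besselCoeff_succ_mul hν n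
  have h2 : (besselCoeff ν (n + 1) : ℂ) * (4 * (n + 1) * (ν + 1 + n)) = -besselCoeff ν n := by
    exact_mod_cast this
  simp only [shiftCoeff]
  push_cast
  linear_combination (z ^ n / 4) * h2

/-- Kept free of division so that it also covers `j = m = 0`, where both sides vanish. Passing to
the next derivative multiplies the case `m + 1` by `m + 1`. -/
theorem shift_iterate_recurrence (hν : -1 < ν) (j m : ℕ) :
    shiftCoeff^[j] (normCoeff ν) (m + 1) * (4 * (m + 1) * (m + j) * (ν + m + j))
      = -(m + j + 1) * shiftCoeff^[j] (normCoeff ν) m := by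
  induction j generalizing m with
  | zero =>
    rcases m with _ | m
    · simp [normCoeff]
    · have := besselCoeff_succ_mul hν m
      simp only [Function.iterate_zero, id, normCoeff]
      push_cast
      linear_combination ((m : ℝ) + 2) * this
  | succ j ih =>
    have := ih (m + 1)
    rw [Function.iterate_succ_apply']
    simp only [shiftCoeff]
    push_cast at this ⊢
    linear_combination ((m : ℝ) + 1) * this

theorem shift_iterate_zero_ne (hν : -1 < ν) (j : ℕ) :
    shiftCoeff^[j + 1] (normCoeff ν) 0 ≠ 0 := by
  induction j with
  | zero => simp [shiftCoeff, normCoeff]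
  | succ j ih =>
    intro h
    have h1 := shift_iterate_recurrence hν (j + 1) 0
    rw [Function.iterate_succ_apply'] at h
    simp only [shiftCoeff, Nat.cast_zero, zero_add, one_mul] at h h1
    rw [h, zero_mul] at h1
    refine mul_ne_zero ?_ ih h1.symm
    push_cast
    have : (0 : ℝ) ≤ j := j.cast_nonneg
    linarith

/-- From the second derivative on, `m + j + 3 ≤ (3/2)(m + j + 2)`, so the ratio given by the
recurrence is at most `(3/8) / (ν + 2)`. -/
theorem shift_iterate_ratio (hν : -1 < ν) {q : ℝ} (hq : 3 / 8 ≤ q * (ν + 2)) (j : ℕ) (m : ℕ) :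
    |shiftCoeff^[j + 2] (normCoeff ν) (m + 1)| ≤ q * |shiftCoeff^[j + 2] (normCoeff ν) m| := by
  have h := shift_iterate_recurrence hν (j + 2) m
  have hj : (0 : ℝ) ≤ j := j.cast_nonneg
  have hm : (0 : ℝ) ≤ m := m.cast_nonneg
  set x := shiftCoeff^[j + 2] (normCoeff ν) (m + 1)
  set y := shiftCoeff^[j + 2] (normCoeff ν) m
  push_cast at h
  have h1 : 0 < ν + m + (j + 2) := by linarith
  have h2 := congrArg abs h
  have hq0 : 0 < q := by
    by_contra hq0
    nlinarith
  rw [abs_mul, abs_mul _ y, abs_neg, abs_of_pos (by positivity : (0 : ℝ) < 4 * (m + 1) * (m + (j + 2)) *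
    (ν + m + (j + 2))), abs_of_pos (by positivity : (0 : ℝ) < (m : ℝ) + (j + 2) + 1)] at h2
  have hD : (0 : ℝ) < 4 * (m + 1) * (m + (j + 2)) * (ν + m + (j + 2)) := by positivity
  refine le_of_mul_le_mul_right ?_ hD
  rw [h2]
  have h3 : (m : ℝ) + (j + 2) + 1 ≤ q * (4 * (m + 1) * (m + (j + 2)) * (ν + m + (j + 2))) := by
    have h4 : 3 / 8 ≤ q * (ν + m + (j + 2)) := by nlinarith
    calc (m : ℝ) + (j + 2) + 1 ≤ 4 * 1 * (m + (j + 2)) * (3 / 8) := by linarith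
      _ ≤ 4 * (m + 1) * (m + (j + 2)) * (q * (ν + m + (j + 2))) := by gcongr; linarith
      _ = _ := by ring
  calc _ ≤ q * (4 * (m + 1) * (m + (j + 2)) * (ν + m + (j + 2))) * |y| := by gcongr
    _ = _ := by ring

theorem hasDerivAt_iteratedDeriv_normalizedBessel (hν : -1 < ν) (k : ℕ) (z : ℂ) :
    HasDerivAt (iteratedDeriv k (normalizedBessel ν)) (pser (shiftCoeff^[k + 1] (normCoeff ν)) z)
      z := by
  rw [normalizedBessel_eq_pser hν, (rapidDecay_normCoeff hν).iteratedDeriv_eq,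
    Function.iterate_succ_apply']
  exact ((rapidDecay_normCoeff hν).shift_iterate k).hasDerivAt z

theorem isCloseToConvexOnDisk_iteratedDeriv (hν : -9 / 16 ≤ ν) {k : ℕ} (hk : 1 ≤ k) :
    IsCloseToConvexOnDisk (iteratedDeriv k (normalizedBessel ν)) := by
  have hν' : -1 < ν := by linarith
  obtain ⟨j, rfl⟩ := Nat.exists_eq_add_of_le' hk
  exact isCloseToConvexOnDisk_of_ratio ((rapidDecay_normCoeff hν').shift_iterate _)
    (shift_iterate_zero_ne hν' _) (hasDerivAt_iteratedDeriv_normalizedBessel hν' _)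
    (q := 3 / 10) (by norm_num) le_rfl (shift_iterate_ratio hν' (by linarith) j)

theorem isConvexOnDisk_iteratedDeriv (hν : -1 / 2 ≤ ν) {k : ℕ} (hk : 1 ≤ k) :
    IsConvexOnDisk (iteratedDeriv k (normalizedBessel ν)) := by
  have hν' : -1 < ν := by linarith
  obtain ⟨j, rfl⟩ := Nat.exists_eq_add_of_le' hk
  exact isConvexOnDisk_of_ratio ((rapidDecay_normCoeff hν').shift_iterate _)
    (shift_iterate_zero_ne hν' _) (hasDerivAt_iteratedDeriv_normalizedBessel hν' _)
    (q := 1 / 4) (by norm_num) le_rfl (shift_iterate_ratio hν' (by linarith) j)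

end Coefficients

/-! ### Sufficiency: the logarithmic derivative on the disk -/

section Disk

variable {ν : ℝ}

/-- The bound `-9/16 = -0.5625` lies just below the root in (a). From `n = 2` on the terms `n²|w n|`
shrink by at least `1/7`, so their sum is at most `7/6` of the term at `2`; comparison with `|w 1|`
leaves a linear inequality in `ν`. -/
theorem weightedCoeff_dominance (hν : -9 / 16 ≤ ν) {p : ℕ} (hp1 : 1 ≤ p) (hp2 : p ≤ 2) :
    Summable (fun n : ℕ => ((n + 2 : ℕ) : ℝ) ^ 2 * |weightedCoeff ν p (n + 2)|) ∧
      ∑' n : ℕ, ((n + 2 : ℕ) : ℝ) ^ 2 * |weightedCoeff ν p (n + 2)| < -weightedCoeff ν p 1 := by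
  have hν' : -1 < ν := by linarith
  set a : ℕ → ℝ := fun n => (n : ℝ) ^ 2 * weightedCoeff ν p n with ha
  have habs : ∀ n, |a n| = (n : ℝ) ^ 2 * |weightedCoeff ν p n| := fun n => by
    rw [ha, abs_mul, abs_of_nonneg (by positivity : (0 : ℝ) ≤ (n : ℝ) ^ 2)]
  have habs' : ∀ n, |weightedCoeff ν p n| = ((n : ℝ) + 1) ^ p * |besselCoeff ν n| := fun n => by
    rw [weightedCoeff, abs_mul, abs_of_nonneg (by positivity : (0 : ℝ) ≤ ((n : ℝ) + 1) ^ p)]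
  have hr : ∀ n, 2 ≤ n → |a (n + 1)| ≤ 1 / 7 * |a n| := by
    intro n hn
    obtain ⟨m, rfl⟩ := Nat.exists_eq_add_of_le' hn
    have hm : (0 : ℝ) ≤ m := m.cast_nonneg
    rw [habs, habs, habs', habs', abs_besselCoeff_succ hν']
    push_cast
    have hd : (0 : ℝ) < ν + 1 + (m + 2) := by linarith
    have hX := abs_nonneg (besselCoeff ν (m + 2))
    set X := |besselCoeff ν (m + 2)|
    have key : 7 * ((m : ℝ) + 2 + 1) * (m + 2 + 1 + 1) ^ p
        ≤ 4 * (m + 2) ^ 2 * (m + 2 + 1) ^ p * (ν + 1 + (m + 2)) := by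
      have h1 : 4 * ((m : ℝ) + 2) ^ 2 * (m + 2 + 1) ^ p * (m + 39 / 16)
          ≤ 4 * (m + 2) ^ 2 * (m + 2 + 1) ^ p * (ν + 1 + (m + 2)) := by
        gcongr ?_ * ?_
        linarith
      refine le_trans ?_ h1
      interval_cases p
      · nlinarith [pow_nonneg hm 2, pow_nonneg hm 3, pow_nonneg hm 4]
      · nlinarith [pow_nonneg hm 2, pow_nonneg hm 3, pow_nonneg hm 4, pow_nonneg hm 5]
    have e : ((m : ℝ) + 2 + 1) ^ 2 * ((m + 2 + 1 + 1) ^ p * (X / (4 * (m + 2 + 1) *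
        (ν + 1 + (m + 2))))) = (7 * ((m : ℝ) + 2 + 1) * (m + 2 + 1 + 1) ^ p) * X /
          (28 * (ν + 1 + (m + 2))) := by
      field_simp
      ring
    rw [e, div_le_iff₀ (by positivity)]
    calc _ ≤ 4 * ((m : ℝ) + 2) ^ 2 * (m + 2 + 1) ^ p * (ν + 1 + (m + 2)) * X := by gcongr
      _ = _ := by ring
  obtain ⟨h1, h2⟩ := tsum_tail_le_of_ratio (by norm_num) (by norm_num) 2 hr
  simp only [habs] at h1 h2
  refine ⟨(summable_nat_add_iff (f := fun n : ℕ => (n : ℝ) ^ 2 * |weightedCoeff ν p n|) 2).2 h1,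
    h2.trans_lt ?_⟩
  rw [habs', show 2 = 1 + 1 from rfl, abs_besselCoeff_succ hν', show 1 = 0 + 1 from rfl,
    abs_besselCoeff_succ hν', weightedCoeff, besselCoeff_succ hν']
  norm_num
  have hA : 0 < ν + 1 := by linarith
  have hB : 0 < ν + 1 + 1 := by linarith
  interval_cases p
  · norm_num
    rw [← sub_pos]
    have : 2 * (1 / (4 * (ν + 1))) - 4 * (3 * (1 / (4 * (ν + 1)) / (4 * 2 * (ν + 1 + 1)))) / (6 / 7)
      = (8 * (ν + 2) - 7) / (16 * (ν + 1) * (ν + 1 + 1)) := by field_simp; ring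
    have h3 : 0 < (8 * (ν + 2) - 7) / (16 * (ν + 1) * (ν + 1 + 1)) := div_pos (by linarith) (by positivity)
    field_simp at h3 ⊢
    linarith
  · norm_num
    rw [← sub_pos]
    have h3 : 0 < (8 * (ν + 2) - 21 / 2) / (16 * (ν + 1) * (ν + 1 + 1)) := div_pos (by linarith) (by positivity)
    field_simp at h3 ⊢
    linarith

theorem re_weighted_lt (hν : -9 / 16 ≤ ν) {p : ℕ} (hp1 : 1 ≤ p) (hp2 : p ≤ 2) {z : ℂ}
    (hz : ‖z‖ < 1) : (pser (weightedCoeff ν p) 1).re < (pser (weightedCoeff ν p) z).re := by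
  obtain ⟨h1, h2⟩ := weightedCoeff_dominance hν hp1 hp2
  exact (rapidDecay_weightedCoeff (by linarith) p).re_lt_re h1 h2 hz

theorem re_pser_besselCoeff_pos (hν : -9 / 16 ≤ ν) {z : ℂ} (hz : ‖z‖ ≤ 1) :
    0 < (pser (besselCoeff ν) z).re := by
  have hν' : -1 < ν := by linarith
  have h1 := (tsum_tail_le_of_ratio (a := besselCoeff ν) (q := 1 / 11) (by norm_num) (by norm_num)
    1 (fun n hn => by
      have hn' : (1 : ℝ) ≤ n := by exact_mod_cast hn
      rw [abs_besselCoeff_succ hν', div_le_iff₀ (by nlinarith)]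
      have : 11 ≤ 4 * ((n : ℝ) + 1) * (ν + 1 + n) := by nlinarith
      nlinarith [abs_nonneg (besselCoeff ν n)])).2
  have h2 := (rapidDecay_besselCoeff hν').norm_sub_le hz
  -- The value `1 / (4 (ν + 1))` at `ν = -9/16`; with the tail factor `11/10` the total stays below
  -- the constant term `1`.
  have h3 : |besselCoeff ν 1| ≤ 4 / 7 := by
    rw [show 1 = 0 + 1 from rfl, abs_besselCoeff_succ hν']
    simp only [besselCoeff_zero, abs_one]
    rw [div_le_iff₀ (by norm_num; linarith)]
    norm_num; linarith
  have h4 := (abs_le.1 (Complex.abs_re_le_norm (pser (besselCoeff ν) z - besselCoeff ν 0))).1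
  simp only [besselCoeff_zero, Complex.ofReal_one, Complex.sub_re, Complex.one_re] at h2 h4
  have h5 : |besselCoeff ν 1| / (1 - 1 / 11) < 1 := by
    rw [div_lt_one (by norm_num)]; linarith
  linarith

theorem pser_besselCoeff_ne_zero (hν : -9 / 16 ≤ ν) {z : ℂ} (hz : ‖z‖ ≤ 1) :
    pser (besselCoeff ν) z ≠ 0 := fun h => by
  have := re_pser_besselCoeff_pos hν hz
  simp [h] at this

/-- `-z g'(z) / g(z)` where `g(z) = f_ν(z) / z`. -/
noncomputable def besselLogDeriv (ν : ℝ) (z : ℂ) : ℂ :=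
  -(z * pser (shiftCoeff (besselCoeff ν)) z) / pser (besselCoeff ν) z

theorem hasDerivAt_besselLogDeriv (hν : -9 / 16 ≤ ν) {z : ℂ} (hz : ‖z‖ ≤ 1) :
    HasDerivAt (besselLogDeriv ν)
      ((-(1 * pser (shiftCoeff (besselCoeff ν)) z +
          z * pser (shiftCoeff (shiftCoeff (besselCoeff ν))) z) * pser (besselCoeff ν) z -
        -(z * pser (shiftCoeff (besselCoeff ν)) z) * pser (shiftCoeff (besselCoeff ν)) z) /
        pser (besselCoeff ν) z ^ 2) z := by
  have hc := rapidDecay_besselCoeff (ν := ν) (by linarith)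
  exact (((hasDerivAt_id z).mul (hc.shift.hasDerivAt z)).neg).div (hc.hasDerivAt z)
    (pser_besselCoeff_ne_zero hν hz)

theorem differentiableOn_besselLogDeriv (hν : -9 / 16 ≤ ν) :
    DifferentiableOn ℂ (besselLogDeriv ν) (Metric.ball 0 1) := fun _ hz =>
  (hasDerivAt_besselLogDeriv hν (mem_ball_zero_iff.1 hz).le).differentiableAt.differentiableWithinAt

theorem nonnegTaylor_besselLogDeriv (hν : -9 / 16 ≤ ν) : NonnegTaylor (besselLogDeriv ν) := by
  have hν' : -1 < ν := by linarith
  refine nonnegTaylor_of_riccati hν' (differentiableOn_besselLogDeriv hν)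
    (by simp [besselLogDeriv]) fun z hz => ?_
  have hz' : ‖z‖ ≤ 1 := (mem_ball_zero_iff.1 hz).le
  have hne := pser_besselCoeff_ne_zero hν hz'
  have hode := bessel_ode hν' z
  rw [(hasDerivAt_besselLogDeriv hν hz').deriv, besselLogDeriv]
  field_simp
  linear_combination (-4 * z * pser (besselCoeff ν) z) * hode

theorem weighted_one_eq (hν : -9 / 16 ≤ ν) {z : ℂ} (hz : ‖z‖ ≤ 1) :
    pser (weightedCoeff ν 1) z = pser (besselCoeff ν) z * (1 - besselLogDeriv ν z) := by
  have hne := pser_besselCoeff_ne_zero hν hz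
  rw [pser_weightedCoeff_one (by linarith), besselLogDeriv]
  field_simp
  ring

variable (hν : -9 / 16 ≤ ν) (h1 : 0 ≤ (pser (weightedCoeff ν 1) 1).re)
include hν h1

/-- At radius `r`, `f_ν'(r) = g(r)(1 - H(r))` with `g(r) > 0` and `f_ν'(r) > f_ν'(1) ≥ 0`. -/
theorem besselLogDeriv_lt_one {z : ℂ} (hz : ‖z‖ < 1) : (besselLogDeriv ν ‖z‖).re < 1 := by
  have hz' : ‖(‖z‖ : ℂ)‖ < 1 := by simpa using hz
  have h2 := re_weighted_lt hν le_rfl one_le_two hz'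
  rw [weighted_one_eq hν hz'.le, pser_ofReal, Complex.re_ofReal_mul] at h2
  have h3 := pos_of_mul_pos_right (h1.trans_lt h2) (re_pser_besselCoeff_pos hν hz'.le).le
  rw [Complex.sub_re, Complex.one_re] at h3
  linarith

theorem re_one_sub_besselLogDeriv_pos {z : ℂ} (hz : ‖z‖ < 1) :
    0 < (1 - besselLogDeriv ν z).re := by
  have h2 := besselLogDeriv_lt_one hν h1 hz
  have h3 := ((nonnegTaylor_besselLogDeriv hν).norm_le hz).1
  have h4 := Complex.re_le_norm (besselLogDeriv ν z)
  rw [Complex.sub_re, Complex.one_re]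
  linarith

theorem re_deriv_normalizedBessel_pos {z : ℂ} (hz : z ∈ Metric.ball (0 : ℂ) 1) :
    0 < (deriv (normalizedBessel ν) z).re := by
  rw [deriv_normalizedBessel (by linarith)]
  exact h1.trans_lt (re_weighted_lt hν le_rfl one_le_two (mem_ball_zero_iff.1 hz))

theorem injOn_normalizedBessel : Set.InjOn (normalizedBessel ν) (Metric.ball 0 1) := by
  refine injOn_of_re_deriv_pos Metric.isOpen_ball (convex_ball _ _) ?_
    fun z hz => re_deriv_normalizedBessel_pos hν h1 hz
  rw [normalizedBessel_eq_pser (by linarith)]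
  exact (rapidDecay_normCoeff (by linarith)).differentiable.differentiableOn

theorem isStarlikeOnDisk_normalizedBessel : IsStarlikeOnDisk (normalizedBessel ν) := by
  have hν' : -1 < ν := by linarith
  have hd : DifferentiableOn ℂ (normalizedBessel ν) (Metric.ball 0 1) := by
    rw [normalizedBessel_eq_pser hν']
    exact (rapidDecay_normCoeff hν').differentiable.differentiableOn
  have h0 : normalizedBessel ν 0 = 0 := by
    rw [normalizedBessel_eq_pser hν', pser_normCoeff hν', zero_mul]
  refine ⟨hd, injOn_normalizedBessel hν h1, h0, starConvex_image_of_re_pos hd h0 ?_⟩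
  intro z hz hz0
  have hz' := mem_ball_zero_iff.1 hz
  have hne := pser_besselCoeff_ne_zero hν hz'.le
  have hpos := re_one_sub_besselLogDeriv_pos hν h1 hz'
  have hne2 : 1 - besselLogDeriv ν z ≠ 0 := fun h => by simp [h] at hpos
  rw [deriv_normalizedBessel hν', normalizedBessel_eq_pser hν', pser_normCoeff hν',
    weighted_one_eq hν hz'.le]
  have : z * pser (besselCoeff ν) z / (z * (pser (besselCoeff ν) z * (1 - besselLogDeriv ν z)))
      = (1 - besselLogDeriv ν z)⁻¹ := by field_simp
  rw [this, Complex.inv_re]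
  exact div_pos hpos (Complex.normSq_pos.2 hne2)

/-- Logarithmic differentiation of `f_ν' = g (1 - H)`, with `z g'/g = -H`. -/
theorem weighted_two_eq {z : ℂ} (hz : ‖z‖ < 1) :
    pser (weightedCoeff ν 2) z = pser (weightedCoeff ν 1) z *
      (1 - (besselLogDeriv ν z + z * deriv (besselLogDeriv ν) z / (1 - besselLogDeriv ν z))) := by
  have hν' : -1 < ν := by linarith
  have hzb : z ∈ Metric.ball (0 : ℂ) 1 := by simpa using hz
  have hc := rapidDecay_besselCoeff hν'
  have hne := pser_besselCoeff_ne_zero hν hz.le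
  have hpos := re_one_sub_besselLogDeriv_pos hν h1 hz
  have hne2 : 1 - besselLogDeriv ν z ≠ 0 := fun h => by simp [h] at hpos
  have hH := (hasDerivAt_besselLogDeriv hν hz.le).differentiableAt.hasDerivAt
  have h2 : HasDerivAt (pser (weightedCoeff ν 1))
      (pser (shiftCoeff (besselCoeff ν)) z * (1 - besselLogDeriv ν z) +
        pser (besselCoeff ν) z * -deriv (besselLogDeriv ν) z) z := by
    refine ((hc.hasDerivAt z).mul (hH.const_sub 1)).congr_of_eventuallyEq ?_
    filter_upwards [Metric.isOpen_ball.mem_nhds hzb] with w hw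
    exact weighted_one_eq hν (mem_ball_zero_iff.1 hw).le
  have h3 := ((rapidDecay_weightedCoeff hν' 1).hasDerivAt z).unique h2
  have h4 : z * pser (shiftCoeff (besselCoeff ν)) z
      = -(besselLogDeriv ν z * pser (besselCoeff ν) z) := by
    rw [besselLogDeriv]; field_simp
  rw [pser_weightedCoeff_two hν', h3, weighted_one_eq hν hz.le]
  generalize besselLogDeriv ν z = H at *
  field_simp
  linear_combination (1 - H) * h4

theorem isConvexOnDisk_normalizedBessel (h2 : 0 ≤ (pser (weightedCoeff ν 2) 1).re) :
    IsConvexOnDisk (normalizedBessel ν) := by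
  have hν' : -1 < ν := by linarith
  refine isConvexOnDisk_of_re_pos ?_ (fun z hz => re_deriv_normalizedBessel_pos hν h1 hz) ?_
  · rw [normalizedBessel_eq_pser hν']
    exact (rapidDecay_normCoeff hν').differentiable.differentiableOn
  intro z hz
  have hz' := mem_ball_zero_iff.1 hz
  have hw1 := re_deriv_normalizedBessel_pos hν h1 hz
  rw [deriv_normalizedBessel hν'] at hw1 ⊢
  rw [(rapidDecay_weightedCoeff hν' 1).deriv_eq]
  have hne : pser (weightedCoeff ν 1) z ≠ 0 := fun h => by simp [h] at hw1
  have e : 1 + z * pser (shiftCoeff (weightedCoeff ν 1)) z / pser (weightedCoeff ν 1) z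
      = 1 - (besselLogDeriv ν z + z * deriv (besselLogDeriv ν) z / (1 - besselLogDeriv ν z)) := by
    have h3 := weighted_two_eq hν h1 hz'
    rw [pser_weightedCoeff_two hν'] at h3
    rw [← mul_right_inj' hne, ← h3]
    field_simp
  rw [e]
  have hH := nonnegTaylor_besselLogDeriv hν
  obtain ⟨hb, hr⟩ := hH.norm_le hz'
  obtain ⟨hb', hr'⟩ := hH.deriv.norm_le hz'
  have hlt : (besselLogDeriv ν ‖z‖).re < 1 := besselLogDeriv_lt_one hν h1 hz'
  have hrr : ‖(‖z‖ : ℂ)‖ < 1 := by simpa using hz'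
  have h4 := h2.trans_lt (re_weighted_lt hν one_le_two le_rfl hrr)
  have h5 := h1.trans_lt (re_weighted_lt hν le_rfl one_le_two hrr)
  have h6 := weighted_two_eq hν h1 hrr
  rw [pser_ofReal (weightedCoeff ν 1), hr, hr'] at h6
  set H := besselLogDeriv ν
  set r := ‖z‖
  set x := (H r).re
  set y := (deriv H r).re
  have h7 := congrArg Complex.re h6
  have e2 : (1 - ((x : ℂ) + r * y / (1 - x))) = ((1 - (x + r * y / (1 - x)) : ℝ) : ℂ) := by
    push_cast; ring
  rw [e2, ← Complex.ofReal_mul, Complex.ofReal_re] at h7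
  rw [h7] at h4
  have h8 : 0 < 1 - (x + r * y / (1 - x)) := pos_of_mul_pos_right h4 h5.le
  -- Nonnegative coefficients bound `H` and `H'` by their radial values, and `|1 - H z| ≥ 1 - H r >
  -- 0` controls the denominator. The radial value is below `1` by `h8`.
  have h9 : ‖H z + z * deriv H z / (1 - H z)‖ ≤ x + r * y / (1 - x) := by
    refine (norm_add_le _ _).trans (add_le_add hb ?_)
    rw [norm_div, norm_mul]
    have h10 : 1 - x ≤ ‖1 - H z‖ := by
      have := norm_sub_norm_le (1 : ℂ) (H z)
      rw [norm_one] at this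
      linarith
    have h11 : 0 ≤ y := (norm_nonneg _).trans hb'
    have h12 : 0 < 1 - x := by linarith
    gcongr
  have := Complex.re_le_norm (H z + z * deriv H z / (1 - H z))
  rw [Complex.sub_re, Complex.one_re]
  linarith

end Disk

/-! ### Necessity of the sign conditions -/

section Converse

variable {ν : ℝ}

theorem normalizedBessel_re_eq (hν : -1 < ν) (x : ℝ) :
    normalizedBessel ν x = ((normalizedBessel ν x).re : ℂ) := by
  rw [normalizedBessel_eq_pser hν]; exact pser_ofReal _ _

theorem hasDerivAt_normalizedBessel_re (hν : -1 < ν) (x : ℝ) :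
    HasDerivAt (fun x : ℝ => (normalizedBessel ν x).re) (pser (weightedCoeff ν 1) x).re x := by
  rw [normalizedBessel_eq_pser hν, ← shiftCoeff_normCoeff]
  exact (rapidDecay_normCoeff hν).hasDerivAt_re x

/-- A continuous injective real function on an interval is strictly monotone, but here the
derivative is `1` at `0` and negative near `1`. -/
theorem not_injOn_normalizedBessel (hν : -1 < ν) (h : (pser (weightedCoeff ν 1) 1).re < 0) :
    ¬ Set.InjOn (normalizedBessel ν) (Metric.ball 0 1) := by
  intro hinj
  set φ : ℝ → ℝ := fun x => (normalizedBessel ν x).re with hφ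
  have hd := hasDerivAt_normalizedBessel_re hν
  have hmem : ∀ x ∈ Set.Ioo (-1 : ℝ) 1, (x : ℂ) ∈ Metric.ball (0 : ℂ) 1 := by
    intro x hx
    rw [mem_ball_zero_iff, Complex.norm_real, Real.norm_eq_abs]
    exact abs_lt.2 hx
  have hφi : Set.InjOn φ (Set.Ioo (-1) 1) := by
    intro x hx y hy hxy
    have : normalizedBessel ν x = normalizedBessel ν y := by
      rw [normalizedBessel_re_eq hν x, normalizedBessel_re_eq hν y]
      exact congrArg _ hxy
    exact_mod_cast hinj (hmem x hx) (hmem y hy) this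
  have hφc : ContinuousOn φ (Set.Ioo (-1) 1) :=
    fun x _ => (hd x).continuousAt.continuousWithinAt
  have hcont : Continuous fun x : ℝ => (pser (weightedCoeff ν 1) x).re :=
    Complex.continuous_re.comp
      ((rapidDecay_weightedCoeff hν 1).differentiable.continuous.comp Complex.continuous_ofReal)
  have hmid : ∃ x ∈ Set.Ioo (-1 : ℝ) 1, (pser (weightedCoeff ν 1) x).re < 0 := by
    have h1 : ∀ᶠ x : ℝ in 𝓝[<] 1, (pser (weightedCoeff ν 1) x).re < 0 ∧ -1 < x :=
      ((hcont.continuousAt.eventually_lt_const (by simpa using h)).and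
        (eventually_gt_nhds (by norm_num))).filter_mono nhdsWithin_le_nhds
    obtain ⟨x, ⟨h2, h3⟩, h4⟩ := (h1.and self_mem_nhdsWithin).exists
    exact ⟨x, ⟨h3, h4⟩, h2⟩
  have hev : ∀ x ∈ Set.Ioo (-1 : ℝ) 1, ∀ᶠ y in 𝓝[>] x, x < y ∧ y ∈ Set.Ioo (-1 : ℝ) 1 := by
    intro x hx
    filter_upwards [self_mem_nhdsWithin, mem_nhdsWithin_of_mem_nhds (Ioo_mem_nhds hx.1 hx.2)]
      with y h1 h2 using ⟨h1, h2⟩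
  rcases hφc.strictMonoOn_of_injOn_Ioo (by norm_num) hφi with hm | hm
  · obtain ⟨x, hx, hneg⟩ := hmid
    obtain ⟨y, hy1, hy2, hy3⟩ := ((hd x).eventually_lt_of_neg hneg |>.and (hev x hx)).exists
    exact absurd (hm hx hy3 hy2) (not_lt.2 hy1.le)
  · have h0 : (0 : ℝ) ∈ Set.Ioo (-1 : ℝ) 1 := by norm_num
    have hd0 := (hd 0).neg
    obtain ⟨y, hy1, hy2, hy3⟩ := (hd0.eventually_lt_of_neg
      (by simp [pser_zero, weightedCoeff]) |>.and (hev 0 h0)).exists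
    have := hm h0 hy3 hy2
    simp only [Pi.neg_apply] at hy1
    linarith

/-- By convexity the midpoint of `f_ν(z)` and its conjugate is in the image. It is real, so
injectivity and conjugation symmetry make its preimage a real `x < 1`, and `f_ν` is nondecreasing on
`[x, 1]`. -/
theorem re_normalizedBessel_le_of_convex (hν : -9 / 16 ≤ ν)
    (h1 : 0 ≤ (pser (weightedCoeff ν 1) 1).re) (hc : IsConvexOnDisk (normalizedBessel ν)) {z : ℂ}
    (hz : ‖z‖ < 1) : (normalizedBessel ν z).re ≤ (normalizedBessel ν 1).re := by
  have hν' : -1 < ν := by linarith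
  have hz1 : z ∈ Metric.ball (0 : ℂ) 1 := mem_ball_zero_iff.2 hz
  have hz2 : starRingEnd ℂ z ∈ Metric.ball (0 : ℂ) 1 := by simpa using hz
  have hconj : ∀ w, normalizedBessel ν (starRingEnd ℂ w) = starRingEnd ℂ (normalizedBessel ν w) := by
    rw [normalizedBessel_eq_pser hν']; exact pser_conj _
  obtain ⟨ζ, hζ, hζe⟩ := hc.2.2 (Set.mem_image_of_mem _ hz1) (Set.mem_image_of_mem _ hz2)
    (by norm_num : (0 : ℝ) ≤ 1 / 2) (by norm_num : (0 : ℝ) ≤ 1 / 2) (by norm_num)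
  have he : normalizedBessel ν ζ = ((normalizedBessel ν z).re : ℂ) := by
    rw [hζe, hconj, ← smul_add, Complex.add_conj, Complex.real_smul]
    push_cast; ring
  have hζc : starRingEnd ℂ ζ ∈ Metric.ball (0 : ℂ) 1 := by simpa using hζ
  have hreal : starRingEnd ℂ ζ = ζ := hc.2.1 hζc hζ (by rw [hconj, he, Complex.conj_ofReal])
  rw [Complex.conj_eq_iff_re] at hreal
  set x := ζ.re
  have hx : |x| < 1 := by
    rw [← hreal, mem_ball_zero_iff, Complex.norm_real] at hζ
    exact hζ
  have hx' := abs_lt.1 hx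
  have hmono : MonotoneOn (fun x : ℝ => (normalizedBessel ν x).re) (Set.Icc x 1) := by
    have hd := hasDerivAt_normalizedBessel_re hν'
    refine monotoneOn_of_deriv_nonneg (convex_Icc _ _)
      (fun y _ => (hd y).continuousAt.continuousWithinAt)
      (fun y _ => (hd y).differentiableAt.differentiableWithinAt) fun y hy => ?_
    rw [interior_Icc] at hy
    rw [(hd y).deriv]
    refine h1.trans (re_weighted_lt hν le_rfl one_le_two ?_).le
    rw [Complex.norm_real]
    exact abs_lt.2 ⟨hx'.1.trans hy.1, hy.2⟩
  have := hmono ⟨le_rfl, hx'.2.le⟩ ⟨hx'.2.le, le_rfl⟩ hx'.2.le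
  simp only [hreal, he, Complex.ofReal_re, Complex.ofReal_one] at this
  exact this

theorem weighted_two_nonneg_of_convex (hν : -9 / 16 ≤ ν)
    (h1 : 0 ≤ (pser (weightedCoeff ν 1) 1).re) (hc : IsConvexOnDisk (normalizedBessel ν)) :
    0 ≤ (pser (weightedCoeff ν 2) 1).re := by
  have hν' : -1 < ν := by linarith
  set f := normalizedBessel ν with hf
  have hfd : ∀ z, HasDerivAt f (pser (weightedCoeff ν 1) z) z := by
    intro z
    have := hasDerivAt_iteratedDeriv_normalizedBessel hν' 0 z
    simpa [shiftCoeff_normCoeff] using this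
  have hfc : Continuous f := continuous_iff_continuousAt.2 fun z => (hfd z).continuousAt
  set γ : ℝ → ℂ := fun θ => (1 : ℝ) * Complex.exp (θ * Complex.I) with hγ
  have hγd : ∀ θ, HasDerivAt γ (γ θ * Complex.I) θ := hasDerivAt_circle 1
  have hγ0 : γ 0 = 1 := by simp [hγ]
  set φ : ℝ → ℝ := fun θ => (f (γ θ)).re with hφ
  have hle : ∀ θ, φ θ ≤ φ 0 := by
    intro θ
    have hcl : closure (Metric.ball (0 : ℂ) 1) ⊆ {z | (f z).re ≤ (f 1).re} := by
      refine closure_minimal (fun z hz => ?_)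
        (isClosed_le (Complex.continuous_re.comp hfc) continuous_const)
      exact re_normalizedBessel_le_of_convex hν h1 hc (mem_ball_zero_iff.1 hz)
    rw [closure_ball _ one_ne_zero] at hcl
    have : γ θ ∈ Metric.closedBall (0 : ℂ) 1 := by
      rw [mem_closedBall_zero_iff, hγ, norm_mul, Complex.norm_exp_ofReal_mul_I]
      simp
    have := hcl this
    simp only [hφ, hγ0]
    exact this
  by_contra hneg
  rw [not_le] at hneg
  have hd1 : ∀ θ, HasDerivAt φ (γ θ * Complex.I * pser (weightedCoeff ν 1) (γ θ)).re θ := fun θ =>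
    Complex.reCLM.hasFDerivAt.comp_hasDerivAt θ (HasDerivAt.scomp θ (hfd (γ θ)) (hγd θ))
  have hd1' : deriv φ = fun θ => (γ θ * Complex.I * pser (weightedCoeff ν 1) (γ θ)).re :=
    funext fun θ => (hd1 θ).deriv
  have hreal : ∀ a : ℕ → ℝ, (pser a 1).im = 0 := by
    intro a
    have := pser_ofReal a 1
    rw [Complex.ofReal_one] at this
    rw [this, Complex.ofReal_im]
  have hd2 : deriv (deriv φ) 0 = -(pser (weightedCoeff ν 2) 1).re := by
    rw [hd1']
    have h3 := ((hγd 0).mul_const Complex.I).mul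
      (HasDerivAt.scomp (0 : ℝ) ((rapidDecay_weightedCoeff hν' 1).hasDerivAt (γ 0)) (hγd 0))
    have h4 := Complex.reCLM.hasFDerivAt.comp_hasDerivAt (0 : ℝ) h3
    refine h4.deriv.trans ?_
    rw [pser_weightedCoeff_two hν']
    simp only [Function.comp_apply, hγ0, smul_eq_mul, one_mul, Complex.reCLM_apply,
      Complex.I_mul_I]
    simp
    ring
  have hd0 : deriv φ 0 = 0 := by
    rw [hd1']
    simp [hγ0, hreal]
  -- A positive second derivative at the global maximum makes it a local minimum as well; then `φ`
  -- is locally constant and its second derivative is zero.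
  have hmin := isLocalMin_of_deriv_deriv_pos (f := φ) (x₀ := 0) (by rw [hd2]; linarith) hd0
    (hd1 0).continuousAt
  have hconst : φ =ᶠ[𝓝 0] fun _ => φ 0 := by
    filter_upwards [hmin] with θ h using le_antisymm (hle θ) h
  have h5 : deriv φ =ᶠ[𝓝 0] fun _ => 0 := by
    have := hconst.deriv
    simpa using this
  have h6 := h5.deriv_eq
  rw [hd2, deriv_const] at h6
  linarith

end Converse

/-! ### Monotonicity and continuity in `ν` -/

section Parameter

/-- `1 / ((ν + 2)(ν + 3) ⋯ (ν + n + 1))`. -/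
noncomputable def invShiftedProd (n : ℕ) (ν : ℝ) : ℝ := ∏ i ∈ Finset.range n, (ν + 2 + i)⁻¹

theorem invShiftedProd_nonneg {ν : ℝ} (hν : -1 < ν) (n : ℕ) : 0 ≤ invShiftedProd n ν :=
  Finset.prod_nonneg fun i _ => inv_nonneg.2 (by linarith [(i.cast_nonneg : (0 : ℝ) ≤ i)])

theorem inv_add_two_add_le {ν : ℝ} (hν : -1 < ν) (n : ℕ) : (ν + 2 + n)⁻¹ ≤ ((n : ℝ) + 1)⁻¹ := by
  have hn : (0 : ℝ) ≤ n := n.cast_nonneg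
  exact inv_anti₀ (by positivity) (by linarith)

theorem invShiftedProd_le_one {ν : ℝ} (hν : -1 < ν) (n : ℕ) : invShiftedProd n ν ≤ 1 := by
  refine Finset.prod_le_one (fun i _ => inv_nonneg.2 ?_) fun i _ => inv_le_one_of_one_le₀ ?_ <;>
  linarith [(i.cast_nonneg : (0 : ℝ) ≤ i)]

/-- Induction by the product rule. For `n ≥ 1` the two pieces carry factors `1/(n + 1)` and `1/(n +
1)²`, each at most `1/2`; for `n = 0` the first piece vanishes. -/
theorem abs_invShiftedProd_sub_le {ν μ : ℝ} (hν : -1 < ν) (hμ : -1 < μ) (n : ℕ) :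
    |invShiftedProd n ν - invShiftedProd n μ| ≤ |ν - μ| := by
  induction n with
  | zero => simp [invShiftedProd]
  | succ n ih =>
    have hn : (0 : ℝ) ≤ n := n.cast_nonneg
    have hx : 0 < ν + 2 + n := by linarith
    have hy : 0 < μ + 2 + n := by linarith
    have hinv : |(ν + 2 + n)⁻¹ - (μ + 2 + n)⁻¹| ≤ ((n : ℝ) + 1)⁻¹ * ((n : ℝ) + 1)⁻¹ * |ν - μ| := by
      have : (ν + 2 + n)⁻¹ - (μ + 2 + n)⁻¹ = (ν + 2 + n)⁻¹ * (μ + 2 + n)⁻¹ * -(ν - μ) := by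
        field_simp; ring
      rw [this, abs_mul, abs_neg, abs_of_pos (by positivity : 0 < (ν + 2 + n)⁻¹ * (μ + 2 + n)⁻¹)]
      refine mul_le_mul_of_nonneg_right (mul_le_mul ?_ ?_ (by positivity) (by positivity))
        (abs_nonneg _)
      · exact inv_add_two_add_le hν n
      · exact inv_add_two_add_le hμ n
    have hsplit : invShiftedProd (n + 1) ν - invShiftedProd (n + 1) μ
        = (invShiftedProd n ν - invShiftedProd n μ) * (ν + 2 + n)⁻¹
          + invShiftedProd n μ * ((ν + 2 + n)⁻¹ - (μ + 2 + n)⁻¹) := by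
      rw [invShiftedProd, invShiftedProd, Finset.prod_range_succ, Finset.prod_range_succ]
      simp only [invShiftedProd]; ring
    have h2 : |invShiftedProd n μ * ((ν + 2 + n)⁻¹ - (μ + 2 + n)⁻¹)|
        ≤ 1 * (((n : ℝ) + 1)⁻¹ * ((n : ℝ) + 1)⁻¹ * |ν - μ|) := by
      rw [abs_mul, abs_of_nonneg (invShiftedProd_nonneg hμ n)]
      gcongr
      exact invShiftedProd_le_one hμ n
    rw [hsplit]
    refine (abs_add_le _ _).trans ?_
    rcases Nat.eq_zero_or_pos n with rfl | hpos
    · simpa [invShiftedProd] using h2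
    · have h1 : |(invShiftedProd n ν - invShiftedProd n μ) * (ν + 2 + n)⁻¹|
          ≤ |ν - μ| * ((n : ℝ) + 1)⁻¹ := by
        rw [abs_mul, abs_of_pos (inv_pos.2 hx)]
        exact mul_le_mul ih (inv_add_two_add_le hν n) (inv_pos.2 hx).le (abs_nonneg _)
      have hn1 : (1 : ℝ) ≤ n := by exact_mod_cast hpos
      have h3 : ((n : ℝ) + 1)⁻¹ ≤ 1 / 2 := by
        rw [one_div]; exact inv_anti₀ (by norm_num) (by linarith)
      have h4 : 0 ≤ ((n : ℝ) + 1)⁻¹ := by positivity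
      have h5 : ((n : ℝ) + 1)⁻¹ * ((n : ℝ) + 1)⁻¹ ≤ 1 / 2 := by nlinarith
      nlinarith [abs_nonneg (ν - μ)]

/-- The coefficients in `ν ↦ (ν + 1) (z d/dz)^p f_ν(1)` from the third on. -/
noncomputable def tailWeight (p n : ℕ) : ℝ :=
  (-1) ^ n * ((n : ℝ) + 3) ^ p / (4 ^ (n + 2) * (n + 2).factorial)

theorem tailWeight_sum {p : ℕ} (hp : p ≤ 2) :
    Summable (fun n => |tailWeight p n|) ∧ ∑' n, |tailWeight p n| ≤ 1 / 2 := by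
  have habs : ∀ n : ℕ, |tailWeight p n| = ((n : ℝ) + 3) ^ p / (4 ^ (n + 2) * (n + 2).factorial) := by
    intro n
    rw [tailWeight, abs_div, abs_mul, abs_pow, abs_neg, abs_one, one_pow, one_mul,
      abs_of_nonneg (by positivity : (0 : ℝ) ≤ ((n : ℝ) + 3) ^ p),
      abs_of_nonneg (by positivity : (0 : ℝ) ≤ 4 ^ (n + 2) * ((n + 2).factorial : ℝ))]
  obtain ⟨h1, h2⟩ := tsum_tail_le_of_ratio (a := tailWeight p) (q := 1 / 6) (by norm_num)
    (by norm_num) 0 (fun n _ => by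
      have hn : (0 : ℝ) ≤ n := n.cast_nonneg
      have hf : (0 : ℝ) < (n + 2).factorial := by exact_mod_cast (n + 2).factorial_pos
      rw [habs, habs, show n + 1 + 2 = (n + 2) + 1 from rfl, Nat.factorial_succ, pow_succ]
      push_cast
      have key : 6 * ((n : ℝ) + 1 + 3) ^ p ≤ 4 * (n + 2 + 1) * (n + 3) ^ p := by
        interval_cases p <;> nlinarith [pow_nonneg hn 2, pow_nonneg hn 3]
      rw [div_le_iff₀ (by positivity)]
      have : 1 / 6 * (((n : ℝ) + 3) ^ p / (4 ^ (n + 2) * (n + 2).factorial)) *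
          (4 ^ (n + 2) * 4 * (((n : ℝ) + 2 + 1) * (n + 2).factorial))
          = 4 * (n + 2 + 1) * (n + 3) ^ p / 6 := by
        field_simp
      rw [this]
      linarith)
  refine ⟨h1, h2.trans ?_⟩
  rw [habs]
  interval_cases p <;> norm_num [Nat.factorial]

variable {ν μ : ℝ}

/-- The factor `ν + 1` cancels the common pole at `ν = -1`: the first two terms become `ν + 1 -
2^p/4`, and the tail is uniformly Lipschitz in `ν`. -/
theorem add_one_mul_pser_weighted (hν : -1 < ν) (p : ℕ) :
    HasSum (fun n => tailWeight p n * invShiftedProd (n + 1) ν)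
      ((ν + 1) * (pser (weightedCoeff ν p) 1).re - (ν + 1) + 2 ^ p / 4) := by
  have hν' : 0 < ν + 1 := by linarith
  have h := (hasSum_nat_add_iff' 2).2
    (((rapidDecay_weightedCoeff hν p).hasSum_real 1).mul_left (ν + 1))
  have e : (ν + 1) * (pser (weightedCoeff ν p) 1).re - (ν + 1) + 2 ^ p / 4
      = (ν + 1) * (pser (weightedCoeff ν p) (1 : ℝ)).re
        - ∑ i ∈ Finset.range 2, (ν + 1) * (weightedCoeff ν p i * 1 ^ i) := by
    have h1 : besselCoeff ν 1 = -(1 / (4 * (ν + 1))) := by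
      rw [show 1 = 0 + 1 from rfl, besselCoeff_succ hν, besselCoeff_zero]
      norm_num
      field_simp
    simp only [Finset.sum_range_succ, Finset.range_zero, Finset.sum_empty, weightedCoeff,
      besselCoeff_zero, h1, Complex.ofReal_one]
    norm_num
    field_simp
    ring
  rw [e]
  refine h.congr_fun fun n => ?_
  rw [weightedCoeff, besselCoeff, tailWeight, invShiftedProd, Finset.prod_range_succ' _ (n + 1),
    Finset.prod_inv_distrib]
  have : ∏ i ∈ Finset.range (n + 1), (ν + 1 + ((i + 1 : ℕ) : ℝ))
      = ∏ i ∈ Finset.range (n + 1), (ν + 2 + i) :=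
    Finset.prod_congr rfl fun i _ => by push_cast; ring
  rw [this]
  have h2 : 0 < ∏ i ∈ Finset.range (n + 1), (ν + 2 + (i : ℝ)) :=
    Finset.prod_pos fun i _ => by linarith [(i.cast_nonneg : (0 : ℝ) ≤ i)]
  push_cast
  rw [one_pow, pow_add (-1 : ℝ) n 2]
  have h3 : (0 : ℝ) < (n + 2).factorial := by exact_mod_cast (n + 2).factorial_pos
  field_simp
  ring

theorem abs_pser_weighted_sub_le (hν : -1 < ν) (hμ : -1 < μ) {p : ℕ} (hp : p ≤ 2) :
    |((ν + 1) * (pser (weightedCoeff ν p) 1).re - (μ + 1) * (pser (weightedCoeff μ p) 1).re)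
      - (ν - μ)| ≤ 1 / 2 * |ν - μ| := by
  obtain ⟨hs, hle⟩ := tailWeight_sum hp
  have h := (add_one_mul_pser_weighted hν p).sub (add_one_mul_pser_weighted hμ p)
  have h2 := h.norm_le_of_bounded (hs.hasSum.mul_right |ν - μ|) fun n => by
    rw [← mul_sub, Real.norm_eq_abs, abs_mul]
    exact mul_le_mul_of_nonneg_left (abs_invShiftedProd_sub_le hν hμ _) (abs_nonneg _)
  rw [Real.norm_eq_abs] at h2
  calc _ = _ := by congr 1; ring
    _ ≤ _ := h2
    _ ≤ _ := mul_le_mul_of_nonneg_right hle (abs_nonneg _)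

theorem pser_weighted_lt (hν : -1 < ν) (hνμ : ν < μ) {p : ℕ} (hp : p ≤ 2) :
    (ν + 1) * (pser (weightedCoeff ν p) 1).re < (μ + 1) * (pser (weightedCoeff μ p) 1).re := by
  have h := abs_pser_weighted_sub_le (hν.trans hνμ) hν hp
  rw [abs_of_pos (sub_pos.2 hνμ)] at h
  have := (abs_le.1 h).1
  linarith

theorem continuousOn_pser_weighted {p : ℕ} (hp : p ≤ 2) :
    ContinuousOn (fun ν : ℝ => (ν + 1) * (pser (weightedCoeff ν p) 1).re) (Set.Ioi (-1)) := by
  have : LipschitzOnWith 2 (fun ν : ℝ => (ν + 1) * (pser (weightedCoeff ν p) 1).re)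
      (Set.Ioi (-1)) := by
    refine LipschitzOnWith.of_dist_le_mul fun x hx y hy => ?_
    have h := abs_le.1 (abs_pser_weighted_sub_le hx hy hp)
    rw [Real.dist_eq, Real.dist_eq, NNReal.coe_ofNat]
    have h2 := abs_le.1 (le_refl |x - y|)
    have h3 := abs_nonneg (x - y)
    exact abs_le.2 ⟨by linarith, by linarith⟩
  exact this.continuousOn

/-- A sign change of `(z d/dz)^p f_ν(1)` in `ν` determines its sign for all `ν > -1`. -/
theorem exists_threshold {p : ℕ} (hp : p ≤ 2) {lo hi : ℝ} (hlo : -1 < lo) (hlt : lo < hi)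
    (h1 : (pser (weightedCoeff lo p) 1).re < 0) (h2 : 0 < (pser (weightedCoeff hi p) 1).re) :
    ∃ ν₀, lo < ν₀ ∧ ν₀ < hi ∧ (pser (weightedCoeff ν₀ p) 1).re = 0 ∧
      (∀ ν, ν₀ < ν → 0 < (pser (weightedCoeff ν p) 1).re) ∧
      (∀ ν, -1 < ν → ν < ν₀ → (pser (weightedCoeff ν p) 1).re < 0) := by
  have hc : ContinuousOn (fun ν : ℝ => (ν + 1) * (pser (weightedCoeff ν p) 1).re) (Set.Icc lo hi) :=
    (continuousOn_pser_weighted hp).mono fun x hx => hlo.trans_le hx.1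
  obtain ⟨ν₀, hν₀, h0⟩ := intermediate_value_Ioo hlt.le hc
    (⟨mul_neg_of_pos_of_neg (by linarith) h1, mul_pos (by linarith) h2⟩ : (0 : ℝ) ∈ Set.Ioo _ _)
  simp only at h0
  have hν₀' : 0 < ν₀ + 1 := by linarith [hν₀.1]
  refine ⟨ν₀, hν₀.1, hν₀.2, (mul_eq_zero.1 h0).resolve_left hν₀'.ne', fun ν h => ?_,
    fun ν hν h => ?_⟩
  · have := pser_weighted_lt (p := p) (by linarith) h hp
    rw [h0] at this
    exact pos_of_mul_pos_right this (by linarith)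
  · have := pser_weighted_lt hν h hp
    rw [h0] at this
    exact neg_of_mul_neg_right this (by linarith)

/-! ### Numerical location of the roots -/

theorem abs_pser_weighted_sub_partial_le (hν : -9 / 16 ≤ ν) {p : ℕ} (hp : p ≤ 2) :
    |(pser (weightedCoeff ν p) 1).re - ∑ n ∈ Finset.range 6, weightedCoeff ν p n|
      ≤ |weightedCoeff ν p 6| / (1 - 1 / 10) := by
  have hν' : -1 < ν := by linarith
  have h := (rapidDecay_weightedCoeff hν' p).hasSum_real 1
  simp only [one_pow, mul_one, Complex.ofReal_one] at h
  rw [← h.tsum_eq]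
  -- Six terms leave an error small enough to decide the sign at endpoints `10⁻⁴` apart; the ratio
  -- `1/10` is generous.
  refine abs_tsum_sub_sum_le_of_ratio (by norm_num) (by norm_num) 6 fun n hn => ?_
  have hn' : (6 : ℝ) ≤ n := by exact_mod_cast hn
  rw [weightedCoeff, weightedCoeff, abs_mul, abs_mul, abs_besselCoeff_succ hν',
    abs_of_nonneg (by positivity : (0 : ℝ) ≤ ((n : ℝ) + 1) ^ p),
    abs_of_nonneg (by positivity : (0 : ℝ) ≤ (((n + 1 : ℕ) : ℝ) + 1) ^ p)]
  push_cast
  have hd : 1 ≤ ν + 1 + n := by linarith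
  have key : 10 * ((n : ℝ) + 1 + 1) ^ p ≤ (n + 1) ^ p * (4 * (n + 1) * (ν + 1 + n)) := by
    have h1 : ((n : ℝ) + 1 + 1) ^ p ≤ (2 * (n + 1)) ^ p := pow_le_pow_left₀ (by linarith) (by linarith) p
    have h2 : (2 : ℝ) ^ p ≤ 4 := by interval_cases p <;> norm_num
    have h3 : 40 ≤ 4 * ((n : ℝ) + 1) * (ν + 1 + n) := by nlinarith
    have h4 : 0 ≤ ((n : ℝ) + 1) ^ p := by positivity
    rw [mul_pow] at h1
    nlinarith
  rw [mul_div_assoc', div_le_iff₀ (by positivity)]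
  have hX := abs_nonneg (besselCoeff ν n)
  nlinarith

theorem weighted_one_lo : (pser (weightedCoeff (-0.5624) 1) 1).re < 0 := by
  have h := (abs_le.1 (abs_pser_weighted_sub_partial_le (ν := -0.5624) (p := 1) (by norm_num)
    (by norm_num))).2
  norm_num [Finset.sum_range_succ, weightedCoeff, besselCoeff, Finset.prod_range_succ,
    Nat.factorial] at h ⊢
  linarith

theorem weighted_one_hi : 0 < (pser (weightedCoeff (-0.5623) 1) 1).re := by
  have h := (abs_le.1 (abs_pser_weighted_sub_partial_le (ν := -0.5623) (p := 1) (by norm_num)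
    (by norm_num))).1
  norm_num [Finset.sum_range_succ, weightedCoeff, besselCoeff, Finset.prod_range_succ,
    Nat.factorial] at h ⊢
  linarith

theorem weighted_two_lo : (pser (weightedCoeff (-0.1439) 2) 1).re < 0 := by
  have h := (abs_le.1 (abs_pser_weighted_sub_partial_le (ν := -0.1439) (p := 2) (by norm_num)
    (by norm_num))).2
  norm_num [Finset.sum_range_succ, weightedCoeff, besselCoeff, Finset.prod_range_succ,
    Nat.factorial] at h ⊢
  linarith

theorem weighted_two_hi : 0 < (pser (weightedCoeff (-0.1438) 2) 1).re := by
  have h := (abs_le.1 (abs_pser_weighted_sub_partial_le (ν := -0.1438) (p := 2) (by norm_num)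
    (by norm_num))).1
  norm_num [Finset.sum_range_succ, weightedCoeff, besselCoeff, Finset.prod_range_succ,
    Nat.factorial] at h ⊢
  linarith

/-! ### Bessel values at `1` -/

theorem shiftCoeff_besselCoeff (hν : -1 < ν) (n : ℕ) :
    shiftCoeff (besselCoeff ν) n = -(1 / (4 * (ν + 1))) * besselCoeff (ν + 1) n := by
  have hν' : 0 < ν + 1 := by linarith
  rw [shiftCoeff, besselCoeff, besselCoeff, Finset.prod_range_succ', Nat.factorial_succ, pow_succ,
    pow_succ]
  have : ∏ i ∈ Finset.range n, (ν + 1 + ((i + 1 : ℕ) : ℝ))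
      = ∏ i ∈ Finset.range n, (ν + 1 + 1 + i) :=
    Finset.prod_congr rfl fun i _ => by push_cast; ring
  rw [this]
  have h2 : 0 < ∏ i ∈ Finset.range n, (ν + 1 + 1 + (i : ℝ)) :=
    Finset.prod_pos fun i _ => by linarith [(i.cast_nonneg : (0 : ℝ) ≤ i)]
  have h3 : (0 : ℝ) < n.factorial := by exact_mod_cast n.factorial_pos
  push_cast
  field_simp
  ring

theorem besselJ_add_one_one (hν : -1 < ν) : besselJ ((ν : ℂ) + 1) 1
    = (1 / 2 : ℂ) ^ (ν : ℂ) / Complex.Gamma ((ν : ℂ) + 1) *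
      (-2 * pser (shiftCoeff (besselCoeff ν)) 1) := by
  have h := besselJ_one (ν := ν + 1) (by linarith)
  have hne : (ν : ℂ) + 1 ≠ 0 := by
    have : ν + 1 ≠ 0 := by linarith
    exact_mod_cast this
  have hG := Gamma_add_one_ne_zero hν
  have hs : pser (shiftCoeff (besselCoeff ν)) 1
      = -(1 / (4 * ((ν : ℂ) + 1))) * pser (besselCoeff (ν + 1)) 1 := by
    rw [pser, pser, ← tsum_mul_left]
    refine tsum_congr fun n => ?_
    rw [shiftCoeff_besselCoeff hν]
    push_cast
    ring
  push_cast at h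
  rw [h, hs, Complex.Gamma_add_one _ hne, Complex.cpow_add _ _ (by norm_num), Complex.cpow_one]
  field_simp
  ring

/-- The left side is `4 (g + 3 g' + g'')` at `1`, and Bessel's equation eliminates `g''`. -/
theorem four_mul_weighted_two_one (hν : -1 < ν) : 4 * pser (weightedCoeff ν 2) 1
    = 3 * pser (besselCoeff ν) 1 - 4 * (ν - 2) * pser (shiftCoeff (besselCoeff ν)) 1 := by
  have hc := rapidDecay_besselCoeff hν
  have h1 := (hc.hasSum 1).add (((hc.mul_pser_shift 1).mul_left 2).add (hc.natMul.mul_pser_shift 1))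
  have h2 : pser (weightedCoeff ν 2) 1 = _ := (h1.congr_fun fun n => by
    simp only [weightedCoeff]
    push_cast
    ring).tsum_eq
  have h3 : pser (shiftCoeff fun n => (n : ℝ) * besselCoeff ν n) 1 = _ :=
    (((hc.shift.hasSum 1).add (hc.shift.mul_pser_shift 1)).congr_fun fun n => by
      simp only [shiftCoeff]
      push_cast
      ring).tsum_eq
  have hode := bessel_ode hν 1
  rw [h2, h3]
  linear_combination 4 * hode

theorem besselJ_combination (hν : -1 < ν) :
    3 * besselJ ν 1 + 2 * ((ν : ℂ) - 2) * besselJ ((ν : ℂ) + 1) 1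
      = (1 / 2 : ℂ) ^ (ν : ℂ) / Complex.Gamma ((ν : ℂ) + 1) * (4 * pser (weightedCoeff ν 2) 1) := by
  rw [besselJ_add_one_one hν, besselJ_one hν, four_mul_weighted_two_one hν]
  ring

theorem pser_one_eq_zero_iff (a : ℕ → ℝ) : pser a 1 = 0 ↔ (pser a 1).re = 0 := by
  have h := pser_ofReal a 1
  rw [Complex.ofReal_one] at h
  constructor
  · intro h0; rw [h0, Complex.zero_re]
  · intro h0; rw [h, h0, Complex.ofReal_zero]

theorem besselJ_combination_eq_zero_iff (hν : -1 < ν) :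
    3 * besselJ ν 1 + 2 * ((ν : ℂ) - 2) * besselJ ((ν : ℂ) + 1) 1 = 0
      ↔ (pser (weightedCoeff ν 2) 1).re = 0 := by
  have h1 : (1 / 2 : ℂ) ^ (ν : ℂ) ≠ 0 := by
    rw [Ne, Complex.cpow_eq_zero_iff]
    norm_num
  rw [besselJ_combination hν, ← pser_one_eq_zero_iff, mul_eq_zero,
    or_iff_right (div_ne_zero h1 (Gamma_add_one_ne_zero hν)), mul_eq_zero,
    or_iff_right (by norm_num : (4 : ℂ) ≠ 0)]

theorem eq_of_threshold {p : ℕ} {ν₀ : ℝ}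
    (hp : ∀ ν, ν₀ < ν → 0 < (pser (weightedCoeff ν p) 1).re)
    (hn : ∀ ν, -1 < ν → ν < ν₀ → (pser (weightedCoeff ν p) 1).re < 0) (hν : -1 < ν)
    (h : (pser (weightedCoeff ν p) 1).re = 0) : ν = ν₀ := by
  rcases lt_trichotomy ν ν₀ with h1 | h1 | h1
  · exact absurd h (hn ν hν h1).ne
  · exact h1
  · exact absurd h (hp ν h1).ne'

end Parameter

/-! ### Assembly of the two parts -/

theorem theorem1 :
    (∃ ν₀ : ℝ,
      (-1 < ν₀ ∧ deriv (normalizedBessel ν₀) 1 = 0 ∧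
        ∀ ν : ℝ, -1 < ν → deriv (normalizedBessel ν) 1 = 0 → ν = ν₀) ∧
      (-0.5624 < ν₀ ∧ ν₀ < -0.5623) ∧
      ∀ ν : ℝ, -1 < ν →
        ((IsStarlikeOnDisk (normalizedBessel ν) ∧
            ∀ k : ℕ, 1 ≤ k → IsCloseToConvexOnDisk (iteratedDeriv k (normalizedBessel ν))) ↔
          ν₀ ≤ ν)) ∧
    (∃ ν₁ : ℝ,
      (-1 < ν₁ ∧ 3 * besselJ ν₁ 1 + 2 * ((ν₁ : ℂ) - 2) * besselJ ((ν₁ : ℂ) + 1) 1 = 0 ∧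
        ∀ ν : ℝ, -1 < ν →
          3 * besselJ ν 1 + 2 * ((ν : ℂ) - 2) * besselJ ((ν : ℂ) + 1) 1 = 0 → ν = ν₁) ∧
      (-0.1439 < ν₁ ∧ ν₁ < -0.1438) ∧
      ∀ ν : ℝ, -1 < ν →
        ((∀ k : ℕ, IsConvexOnDisk (iteratedDeriv k (normalizedBessel ν))) ↔ ν₁ ≤ ν)) := by
  obtain ⟨ν₀, hlo, hhi, hz, hpos, hneg⟩ := exists_threshold (p := 1) (by norm_num)
    (by norm_num) (by norm_num) weighted_one_lo weighted_one_hi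
  obtain ⟨ν₁, hlo', hhi', hz', hpos', hneg'⟩ := exists_threshold (p := 2) le_rfl
    (by norm_num) (by norm_num) weighted_two_lo weighted_two_hi
  have hnonneg : ∀ ν, ν₀ ≤ ν → 0 ≤ (pser (weightedCoeff ν 1) 1).re := fun ν h =>
    h.eq_or_lt.elim (fun h => by rw [← h, hz]) fun h => (hpos ν h).le
  have hnonneg' : ∀ ν, ν₁ ≤ ν → 0 ≤ (pser (weightedCoeff ν 2) 1).re := fun ν h =>
    h.eq_or_lt.elim (fun h => by rw [← h, hz']) fun h => (hpos' ν h).le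
  have hν₀ : -1 < ν₀ := by linarith
  have hν₁ : -1 < ν₁ := by linarith
  refine ⟨⟨ν₀, ⟨hν₀, ?_, fun ν hν h => ?_⟩, ⟨hlo, hhi⟩, fun ν hν => ⟨fun h => ?_, fun h => ?_⟩⟩,
    ⟨ν₁, ⟨hν₁, ?_, fun ν hν h => ?_⟩, ⟨hlo', hhi'⟩, fun ν hν => ⟨fun h => ?_, fun h k => ?_⟩⟩⟩
  · rw [deriv_normalizedBessel hν₀, pser_one_eq_zero_iff, hz]
  · rw [deriv_normalizedBessel hν, pser_one_eq_zero_iff] at h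
    exact eq_of_threshold hpos hneg hν h
  · by_contra hlt
    exact not_injOn_normalizedBessel hν (hneg ν hν (not_le.1 hlt)) h.1.2.1
  · have hν' : -9 / 16 ≤ ν := by linarith
    exact ⟨isStarlikeOnDisk_normalizedBessel hν' (hnonneg ν h),
      fun k hk => isCloseToConvexOnDisk_iteratedDeriv hν' hk⟩
  · rw [besselJ_combination_eq_zero_iff hν₁, hz']
  · rw [besselJ_combination_eq_zero_iff hν] at h
    exact eq_of_threshold hpos' hneg' hν h
  · have hc : IsConvexOnDisk (normalizedBessel ν) := by simpa using h 0
    by_contra hlt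
    -- The circle argument needs `f_ν'(1) ≥ 0`, so below `ν₀` univalence is refuted instead.
    rcases lt_or_ge ν ν₀ with h0 | h0
    · exact not_injOn_normalizedBessel hν (hneg ν hν h0) hc.2.1
    · exact absurd (hneg' ν hν (not_le.1 hlt))
        (not_lt.2 (weighted_two_nonneg_of_convex (by linarith) (hnonneg ν h0) hc))
  · rcases Nat.eq_zero_or_pos k with rfl | hk
    · simpa using isConvexOnDisk_normalizedBessel (by linarith) (hnonneg ν (by linarith))
        (hnonneg' ν h)
    · exact isConvexOnDisk_iteratedDeriv (by linarith) hk
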